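/- Let $k$ be an algebraically closed field, let $n\ge 3$ and $N\ge 4$ be integers, and let $B=k^{\oplus n}$ with its standard idempotents $(1),\dots,(n)$. Let $\Gamma_n$ be the cyclic quiver with vertices $1,\dots,n$ (indices modulo $n$) and arrows $(i|i+1)$ and $(i+1|i)$ for $i=1,\dots,n$; write $(i_0|\cdots|i_m)$ for the path through $i_0,\dots,i_m$, and compose paths by concatenation from left to right. Let $R_{n,N}$ be the quotient of the path algebra $k\Gamma_n$ by the relations $$(i|i-1|i)=(i|i+1|i),\qquad (i-1|i|i+1)=0=(i+1|i|i-1)\qquad (i=1,\dots,n),$$ with the (first, cohomological) grading given by $\deg(i)=0$, $\deg(i|i+1)=d_i$, $\deg(i+1|i)=N-d_i$, where, for $i=1,\dots,n$, $d_i=\tfrac12N$ if $N$ is even and $d_i=\tfrac12(N+(-1)^i)$ if $N$ is odd. (The algebra also carries a second grading, which plays no role here.) A dg algebra over $B$ is a $\mathbb Z$-graded unital $k$-algebra $C=\bigoplus_i C^i$ with a $k$-linear differential of degree $+1$ satisfying the graded Leibniz rule, together with a unital $k$-algebra homomorphism $B\to C^0$ (not necessarily central) on whose image the differential vanishes; homomorphisms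 are degree-preserving and compatible with the differentials and with $B$. It is called formal if it is connected by a finite chain of quasi-isomorphisms of dg algebras over $B$ to its cohomology algebra $H(C)$ with zero differential. Then $R_{n,N}$ is intrinsically formal: every dg algebra $C$ over $B$ with $H(C)\cong R_{n,N}$ as graded algebras over $B$ is formal. -/

import Mathlib

/-!
Differential graded algebras over the semisimple ground ring `k^V` (`V` a finite set), cohomology,
formality and intrinsic formality, and the zig-zag algebra of the cyclic quiver.
-/

universe u w w'

/-- A `ℤ`-graded algebra over the ground ring `k^V`: a `k`-algebra `A = ⨁ i, A^i` together with a
unital algebra homomorphism `k^V → A^0`. The latter is the same as a complete family of orthogonal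
idempotents `e v` (`v ∈ V`) in `A^0`; the image of `k^V` need not be central. -/
structure GrAlg (k : Type u) [Field k] (V : Type) [Fintype V] where
  carrier : Type w
  [ring : Ring carrier]
  [algebra : Algebra k carrier]
  /-- the homogeneous parts -/
  gr : ℤ → Submodule k carrier
  [gradedMonoid : SetLike.GradedMonoid gr]
  isInternal : DirectSum.IsInternal gr
  /-- the idempotents of the ground ring -/
  e : V → carrier
  complete : CompleteOrthogonalIdempotents e
  e_mem : ∀ v, e v ∈ gr 0

attribute [instance] GrAlg.ring GrAlg.algebra GrAlg.gradedMonoid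

/-- Isomorphisms of graded algebras over `k^V`. -/
structure GrAlg.Iso {k : Type u} [Field k] {V : Type} [Fintype V]
    (A : GrAlg.{u, w} k V) (B : GrAlg.{u, w'} k V) where
  toAlgEquiv : A.carrier ≃ₐ[k] B.carrier
  map_gr : ∀ i x, toAlgEquiv x ∈ B.gr i ↔ x ∈ A.gr i
  map_e : ∀ v, toAlgEquiv (A.e v) = B.e v

/-- A differential graded algebra over the ground ring `k^V`: a graded algebra with a differential
of degree `1` that satisfies the graded Leibniz rule and vanishes on `k^V`. -/
structure DGAlg (k : Type u) [Field k] (V : Type) [Fintype V] extends GrAlg.{u, w} k V where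
  d : carrier →ₗ[k] carrier
  d_mem : ∀ i x, x ∈ gr i → d x ∈ gr (i + 1)
  d_d : ∀ x, d (d x) = 0
  d_mul : ∀ i x y, x ∈ gr i → d (x * y) = d x * y + i.negOnePow • (x * d y)
  d_e : ∀ v, d (e v) = 0

/-- Homomorphisms of differential graded algebras over `k^V`. -/
structure DGAlg.Hom {k : Type u} [Field k] {V : Type} [Fintype V]
    (C D : DGAlg.{u, w} k V) where
  toAlgHom : C.carrier →ₐ[k] D.carrier
  map_gr : ∀ i x, x ∈ C.gr i → toAlgHom x ∈ D.gr i
  map_d : ∀ x, toAlgHom (C.d x) = D.d (toAlgHom x)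
  map_e : ∀ v, toAlgHom (C.e v) = D.e v

/-- A graded algebra, regarded as a differential graded algebra with zero differential. -/
def GrAlg.toDGAlg {k : Type u} [Field k] {V : Type} [Fintype V] (A : GrAlg.{u, w} k V) :
    DGAlg.{u, w} k V where
  toGrAlg := A
  d := 0
  d_mem i x _ := by simp
  d_d x := by simp
  d_mul i x y _ := by simp
  d_e v := by simp

/-! ### Cohomology -/

namespace DGAlg

variable {k : Type u} [Field k] {V : Type} [Fintype V] (C : DGAlg.{u, w} k V)

theorem induction_gr {p : C.carrier → Prop} (x : C.carrier) (h0 : p 0)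
    (hadd : ∀ x y, p x → p y → p (x + y)) (h : ∀ i x, x ∈ C.gr i → p x) : p x :=
  Submodule.iSup_induction C.gr (motive := p)
    (by rw [C.isInternal.submodule_iSup_eq_top]; trivial) (fun i x hx => h i x hx) h0 hadd

/-- The projection to the part of degree `i`. -/
noncomputable def proj (i : ℤ) : C.carrier →ₗ[k] C.carrier :=
  letI := C.isInternal.chooseDecomposition
  (C.gr i).subtype ∘ₗ DirectSum.component k ℤ (fun i => C.gr i) i ∘ₗ
    (DirectSum.decomposeLinearEquiv C.gr).toLinearMap

theorem proj_mem (i : ℤ) (x : C.carrier) : C.proj i x ∈ C.gr i := by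
  simp [proj]

theorem proj_same {i : ℤ} {x : C.carrier} (hx : x ∈ C.gr i) : C.proj i x = x := by
  let := C.isInternal.chooseDecomposition
  exact DirectSum.decompose_of_mem_same C.gr hx

theorem proj_ne {i j : ℤ} {x : C.carrier} (hx : x ∈ C.gr i) (hij : i ≠ j) : C.proj j x = 0 := by
  let := C.isInternal.chooseDecomposition
  exact DirectSum.decompose_of_mem_ne C.gr hx hij

theorem proj_d (i : ℤ) (x : C.carrier) : C.proj (i + 1) (C.d x) = C.d (C.proj i x) := by
  refine C.induction_gr (p := fun x => C.proj (i + 1) (C.d x) = C.d (C.proj i x)) x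
    (by simp) (fun x y hx hy => by simp [hx, hy]) ?_
  intro j x hx
  by_cases h : j = i
  · subst h
    rw [C.proj_same hx, C.proj_same (C.d_mem _ _ hx)]
  · rw [C.proj_ne hx h, C.proj_ne (C.d_mem _ _ hx) (by omega), map_zero]

theorem sum_proj (x : C.carrier) : ∃ s : Finset ℤ, x = ∑ i ∈ s, C.proj i x := by
  let := C.isInternal.chooseDecomposition
  classical
  exact ⟨_, (DirectSum.sum_support_decompose C.gr x).symm⟩

theorem d_mul_of_right {y : C.carrier} (hy : C.d y = 0) (x : C.carrier) :
    C.d (x * y) = C.d x * y := by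
  refine C.induction_gr (p := fun x => C.d (x * y) = C.d x * y) x
    (by simp) (fun x x' hx hx' => by simp [add_mul, hx, hx']) ?_
  intro i x hx
  simp [C.d_mul i x y hx, hy]

theorem d_one : C.d 1 = 0 := by
  have h := C.d_mul 0 1 1 SetLike.GradedOne.one_mem
  simpa using h

/-- The subalgebra of cocycles. -/
def cocycles : Subalgebra k C.carrier where
  carrier := {x | C.d x = 0}
  mul_mem' {x y} hx hy := by
    have hx : C.d x = 0 := hx
    have hy : C.d y = 0 := hy
    simp [C.d_mul_of_right hy, hx]
  add_mem' {x y} hx hy := by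
    have hx : C.d x = 0 := hx
    have hy : C.d y = 0 := hy
    simp [hx, hy]
  algebraMap_mem' r := by
    simp [Algebra.algebraMap_eq_smul_one, C.d_one]

theorem mem_cocycles {x : C.carrier} : x ∈ C.cocycles ↔ C.d x = 0 := Iff.rfl

theorem exists_mul_d {z : C.carrier} (hz : C.d z = 0) (y : C.carrier) :
    ∃ x, C.d x = z * C.d y := by
  obtain ⟨s, hs⟩ := C.sum_proj z
  refine ⟨∑ i ∈ s, i.negOnePow • (C.proj i z * y), ?_⟩
  conv_rhs => rw [hs, Finset.sum_mul]
  rw [map_sum]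
  refine Finset.sum_congr rfl fun i _ => ?_
  have h0 : C.d (C.proj i z) = 0 := by rw [← proj_d, hz, map_zero]
  have h1 := C.d_mul i _ y (C.proj_mem i z)
  rw [h0, zero_mul, zero_add] at h1
  rw [Units.smul_def, map_zsmul, ← Units.smul_def, h1, smul_smul]
  simp

/-- The ideal of coboundaries in the algebra of cocycles. -/
def coboundaries : Ideal C.cocycles where
  carrier := {z | ∃ x, C.d x = z}
  add_mem' := by
    rintro a b ⟨x, hx⟩ ⟨y, hy⟩
    exact ⟨x + y, by simp [hx, hy]⟩
  zero_mem' := ⟨0, by simp⟩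
  smul_mem' := by
    rintro c a ⟨y, hy⟩
    obtain ⟨x, hx⟩ := C.exists_mul_d c.2 y
    exact ⟨x, by simp [hx, hy]⟩

theorem mem_coboundaries {z : C.cocycles} : z ∈ C.coboundaries ↔ ∃ x, C.d x = z := Iff.rfl

instance : C.coboundaries.IsTwoSided where
  mul_mem_of_left := by
    rintro a b ⟨x, hx⟩
    exact ⟨x * b, by simp [C.d_mul_of_right b.2, hx]⟩

/-- The cohomology algebra `H(C) = ker d / im d`. -/
abbrev H : Type w := C.cocycles ⧸ C.coboundaries

/-- The class of a cocycle. -/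
def cls : C.cocycles →ₐ[k] C.H := Ideal.Quotient.mkₐ k C.coboundaries

theorem cls_surjective : Function.Surjective C.cls := Ideal.Quotient.mkₐ_surjective k _

theorem cls_eq_zero {z : C.cocycles} : C.cls z = 0 ↔ ∃ x, C.d x = z := by
  rw [← mem_coboundaries]
  exact Ideal.Quotient.eq_zero_iff_mem

/-- `H^i(C)`: the classes of the cocycles of degree `i`. -/
def Hgr (i : ℤ) : Submodule k C.H :=
  ((C.gr i).comap C.cocycles.val.toLinearMap).map C.cls.toLinearMap

theorem mem_Hgr {i : ℤ} {x : C.H} :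
    x ∈ C.Hgr i ↔ ∃ z : C.cocycles, (z : C.carrier) ∈ C.gr i ∧ C.cls z = x := Iff.rfl

instance : SetLike.GradedMonoid C.Hgr where
  one_mem := ⟨1, SetLike.GradedOne.one_mem (A := C.gr), map_one C.cls⟩
  mul_mem := by
    rintro i j _ _ ⟨x, hx, rfl⟩ ⟨y, hy, rfl⟩
    exact ⟨x * y, SetLike.GradedMul.mul_mem (A := C.gr) hx hy, map_mul C.cls x y⟩

theorem isInternal_Hgr : DirectSum.IsInternal C.Hgr := by
  rw [DirectSum.isInternal_submodule_iff_iSupIndep_and_iSup_eq_top]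
  constructor
  · intro i
    rw [Submodule.disjoint_def]
    rintro _ ⟨z, hz, rfl⟩ hx
    have key : ∀ x ∈ ⨆ j, ⨆ (_ : j ≠ i), C.Hgr j,
        ∃ z : C.cocycles, C.proj i z = 0 ∧ C.cls z = x := by
      intro x hx
      induction hx using Submodule.iSup_induction' with
      | mem j x hx =>
        by_cases hj : j = i
        · have : x = 0 := by simpa [hj] using hx
          exact ⟨0, by simp, by simp [this]⟩
        · simp only [ne_eq, hj, not_false_eq_true, iSup_pos] at hx
          obtain ⟨z, hz, rfl⟩ := hx
          exact ⟨z, C.proj_ne hz hj, rfl⟩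
      | zero => exact ⟨0, by simp, by simp⟩
      | add x y _ _ hx hy =>
        obtain ⟨a, ha, rfl⟩ := hx
        obtain ⟨b, hb, rfl⟩ := hy
        exact ⟨a + b, by simp [ha, hb], by simp⟩
    obtain ⟨z', hz', h⟩ := key _ hx
    have h2 : C.cls (z - z') = 0 := by
      rw [map_sub, h]
      exact sub_self _
    obtain ⟨x, hx⟩ := C.cls_eq_zero.1 h2
    refine C.cls_eq_zero.2 ⟨C.proj (i - 1) x, ?_⟩
    rw [← proj_d, hx, sub_add_cancel]
    have hz : (z : C.carrier) ∈ C.gr i := hz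
    simp [hz', C.proj_same hz]
  · rw [eq_top_iff]
    rintro x -
    obtain ⟨z, rfl⟩ := C.cls_surjective x
    obtain ⟨s, hs⟩ := C.sum_proj z
    have hmem : ∀ i, C.proj i z ∈ C.cocycles := fun i => by
      rw [mem_cocycles, ← proj_d, C.mem_cocycles.1 z.2, map_zero]
    have : z = ∑ i ∈ s, (⟨C.proj i z, hmem i⟩ : C.cocycles) := by
      apply Subtype.ext
      rw [AddSubmonoidClass.coe_finsetSum]
      exact hs
    rw [this, map_sum]
    exact Submodule.sum_mem _ fun i _ =>
      Submodule.mem_iSup_of_mem i (C.mem_Hgr.2 ⟨_, C.proj_mem i _, rfl⟩)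

/-- The cohomology of a differential graded algebra over `k^V`, as a graded algebra over `k^V`. -/
abbrev cohomology : GrAlg.{u, w} k V where
  carrier := C.H
  gr := C.Hgr
  isInternal := C.isInternal_Hgr
  e v := C.cls ⟨C.e v, C.d_e v⟩
  complete := by
    have h : CompleteOrthogonalIdempotents (fun v => (⟨C.e v, C.d_e v⟩ : C.cocycles)) :=
      { idem := fun v => Subtype.ext (C.complete.idem v)
        ortho := fun v v' hv => Subtype.ext (C.complete.ortho hv)
        complete := Subtype.ext (by
          rw [AddSubmonoidClass.coe_finsetSum]
          exact C.complete.complete) }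
    exact h.map C.cls.toRingHom
  e_mem v := C.mem_Hgr.2 ⟨_, C.e_mem v, rfl⟩

variable {C} {D : DGAlg.{u, w} k V}

/-- The restriction of a homomorphism to cocycles. -/
def Hom.mapCocycles (f : Hom C D) : C.cocycles →ₐ[k] D.cocycles :=
  (f.toAlgHom.comp C.cocycles.val).codRestrict D.cocycles fun z => by
    rw [mem_cocycles, AlgHom.comp_apply, ← f.map_d]
    exact (congrArg f.toAlgHom z.2).trans (map_zero _)

/-- The map `H(C) → H(D)` induced by a homomorphism `C → D`. -/
def Hom.mapH (f : Hom C D) : C.H →+* D.H :=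
  Ideal.quotientMap D.coboundaries f.mapCocycles.toRingHom (by
    rintro z ⟨x, hx⟩
    exact ⟨f.toAlgHom x, by rw [← f.map_d, hx]; rfl⟩)

/-- A quasi-isomorphism is a homomorphism that induces an isomorphism in cohomology. -/
def Hom.IsQuasiIso (f : Hom C D) : Prop := Function.Bijective f.mapH

/-- Two differential graded algebras are quasi-isomorphic if they are connected by a finite chain
of quasi-isomorphisms (in either direction). -/
def QuasiIsomorphic : DGAlg.{u, w} k V → DGAlg.{u, w} k V → Prop :=
  Relation.EqvGen fun C D => ∃ f : Hom C D, f.IsQuasiIso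

/-- A differential graded algebra is formal if it is quasi-isomorphic to its cohomology algebra
(with zero differential). -/
def IsFormal (C : DGAlg.{u, w} k V) : Prop := QuasiIsomorphic C C.cohomology.toDGAlg

end DGAlg

/-- A graded algebra `A` over `k^V` is intrinsically formal if every differential graded algebra
over `k^V` with cohomology algebra isomorphic to `A` is formal. -/
def GrAlg.IsIntrinsicallyFormal {k : Type u} [Field k] {V : Type} [Fintype V]
    (A : GrAlg.{u, u} k V) : Prop :=
  ∀ C : DGAlg.{u, max u w} k V, Nonempty (C.cohomology.Iso A) → C.IsFormal

/-! ### The zig-zag algebra -/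

/-- The vertices and arrows of the cyclic quiver `Γ_n` with vertices `1, …, n` (indexed by
`ZMod n`): the trivial path `(i)` and the arrows `(i|i+1)` and `(i+1|i)`, for `i` modulo `n`. -/
inductive ZigzagGen (n : ℕ) : Type
  | vertex (i : ZMod n)
  | up (i : ZMod n)
  | down (i : ZMod n)

namespace Zigzag

/-- The representative of `i` in `{1, …, n}`. -/
def label {n : ℕ} (i : ZMod n) : ℕ := if i.val = 0 then n else i.val

/-- `d_i = N/2` for even `N` and `d_i = (N + (-1)^i)/2` for odd `N`, for `i = 1, …, n`. -/
def dd (N : ℕ) {n : ℕ} (i : ZMod n) : ℤ :=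
  if Even N then (N : ℤ) / 2 else ((N : ℤ) + (-1) ^ label i) / 2

/-- The degrees: `deg (i) = 0`, `deg (i|i+1) = d_i`, `deg (i+1|i) = N - d_i`. -/
def deg (N : ℕ) {n : ℕ} : ZigzagGen n → ℤ
  | .vertex _ => 0
  | .up i => dd N i
  | .down i => N - dd N i

variable (k : Type u) [Field k] (n : ℕ) [NeZero n]

section
variable {n}
/-- The path `(i)`. -/
def fv (i : ZMod n) : FreeAlgebra k (ZigzagGen n) := FreeAlgebra.ι k (.vertex i)
/-- The path `(i|i+1)`. -/
def fu (i : ZMod n) : FreeAlgebra k (ZigzagGen n) := FreeAlgebra.ι k (.up i)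
/-- The path `(i+1|i)`. -/
def fd (i : ZMod n) : FreeAlgebra k (ZigzagGen n) := FreeAlgebra.ι k (.down i)
end

/-- The relations of the zig-zag algebra. The first seven present the path algebra of the cyclic
quiver, where paths are composed from left to right, `(i|j)(j|l) = (i|j|l)`; the last three are the
zig-zag relations `(i|i+1|i) = (i|i-1|i)` and `(i-1|i|i+1) = 0 = (i+1|i|i-1)`. -/
inductive Rel : FreeAlgebra k (ZigzagGen n) → FreeAlgebra k (ZigzagGen n) → Prop
  | idem (i : ZMod n) : Rel (fv k i * fv k i) (fv k i)
  | ortho (i j : ZMod n) (h : i ≠ j) : Rel (fv k i * fv k j) 0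
  | one : Rel (∑ i, fv k i) 1
  | up_source (i : ZMod n) : Rel (fv k i * fu k i) (fu k i)
  | up_target (i : ZMod n) : Rel (fu k i * fv k (i + 1)) (fu k i)
  | down_source (i : ZMod n) : Rel (fv k (i + 1) * fd k i) (fd k i)
  | down_target (i : ZMod n) : Rel (fd k i * fv k i) (fd k i)
  | loop (i : ZMod n) : Rel (fu k i * fd k i) (fd k (i - 1) * fu k (i - 1))
  | up_up (i : ZMod n) : Rel (fu k (i - 1) * fu k i) 0
  | down_down (i : ZMod n) : Rel (fd k i * fd k (i - 1)) 0

/-- The underlying algebra of the zig-zag algebra `R_n`. -/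
abbrev Alg : Type u := RingQuot (Rel k n)

section
variable {n}
/-- The image of a generator in the zig-zag algebra. -/
def gen (g : ZigzagGen n) : Alg k n := RingQuot.mkAlgHom k (Rel k n) (FreeAlgebra.ι k g)
end

/-- The degree `i` part of `R_{n,N}`: the span of the words in the generators (each of which is
a path or zero) of total degree `i`. -/
def gr (N : ℕ) (i : ℤ) : Submodule k (Alg k n) :=
  Submodule.span k {x | ∃ l : List (ZigzagGen n), (l.map (deg N)).sum = i ∧ (l.map (gen k)).prod = x}

theorem gen_mem (N : ℕ) (g : ZigzagGen n) : gen k g ∈ gr k n N (deg N g) :=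
  Submodule.subset_span ⟨[g], by simp, by simp⟩

instance (N : ℕ) : SetLike.GradedMonoid (gr k n N) where
  one_mem := Submodule.subset_span ⟨[], by simp, by simp⟩
  mul_mem := by
    intro i j x y hx hy
    have h : gr k n N i * gr k n N j ≤ gr k n N (i + j) := by
      rw [gr, gr, Submodule.span_mul_span]
      apply Submodule.span_mono
      rintro _ ⟨_, ⟨l, hl, rfl⟩, _, ⟨l', hl', rfl⟩, rfl⟩
      exact ⟨l ++ l', by simp [hl, hl'], by simp⟩
    exact h (Submodule.mul_mem_mul hx hy)

theorem rel {x y : FreeAlgebra k (ZigzagGen n)} (h : Rel k n x y) :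
    RingQuot.mkAlgHom k (Rel k n) x = RingQuot.mkAlgHom k (Rel k n) y :=
  RingQuot.mkAlgHom_rel k h

/-- A generator in the direct sum of the homogeneous parts. -/
def genD (N : ℕ) (g : ZigzagGen n) : DirectSum ℤ fun i => gr k n N i :=
  DirectSum.of (fun i => gr k n N i) (deg N g) ⟨gen k g, gen_mem k n N g⟩

theorem of_eq (N : ℕ) {i j : ℤ} (hij : i = j) {x : gr k n N i} {y : gr k n N j}
    (h : (x : Alg k n) = y) :
    DirectSum.of (fun i => gr k n N i) i x = DirectSum.of (fun i => gr k n N i) j y := by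
  subst hij
  rw [Subtype.ext h]

theorem of_eq_zero (N : ℕ) {i : ℤ} {x : gr k n N i} (h : (x : Alg k n) = 0) :
    DirectSum.of (fun i => gr k n N i) i x = 0 := by
  rw [show x = 0 from Subtype.ext h, map_zero]

/-- The decomposition of the zig-zag algebra into homogeneous parts. -/
noncomputable def decomp (N : ℕ) : Alg k n →ₐ[k] DirectSum ℤ fun i => gr k n N i :=
  RingQuot.liftAlgHom k ⟨FreeAlgebra.lift k (genD k n N), by
    have two : ∀ g h g' : ZigzagGen n, deg N g + deg N h = deg N g' →
        gen k g * gen k h = gen k g' → genD k n N g * genD k n N h = genD k n N g' := by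
      intro g h g' hd hm
      rw [genD, genD, DirectSum.of_mul_of]
      exact of_eq k n N hd hm
    have zero : ∀ g h : ZigzagGen n, gen k g * gen k h = 0 →
        genD k n N g * genD k n N h = 0 := by
      intro g h hm
      rw [genD, genD, DirectSum.of_mul_of]
      exact of_eq_zero k n N hm
    intro x y h
    have hr := rel k n h
    cases h <;> simp only [fv, fu, fd, map_mul, map_sum, map_one, map_zero,
      FreeAlgebra.lift_ι_apply] at hr ⊢
    · exact two _ _ _ (by simp [deg]) hr
    · exact zero _ _ hr
    · have : ∀ i : ZMod n, genD k n N (.vertex i) =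
          DirectSum.of (fun i => gr k n N i) 0 ⟨gen k (.vertex i), gen_mem k n N (.vertex i)⟩ :=
        fun _ => rfl
      simp only [this]
      rw [← map_sum]
      refine of_eq k n N rfl ?_
      rw [AddSubmonoidClass.coe_finsetSum]
      exact hr
    · exact two _ _ _ (by simp [deg]) hr
    · exact two _ _ _ (by simp [deg]) hr
    · exact two _ _ _ (by simp [deg]) hr
    · exact two _ _ _ (by simp [deg]) hr
    · rw [genD, genD, genD, genD, DirectSum.of_mul_of, DirectSum.of_mul_of]
      exact of_eq k n N (by simp [deg]) hr
    · exact zero _ _ hr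
    · exact zero _ _ hr⟩

theorem decomp_gen (N : ℕ) (g : ZigzagGen n) : decomp k n N (gen k g) = genD k n N g := by
  simp [decomp, gen]

theorem decomp_of_mem (N : ℕ) {i : ℤ} (x : gr k n N i) :
    decomp k n N x = DirectSum.of (fun i => gr k n N i) i x := by
  obtain ⟨x, hx⟩ := x
  induction hx using Submodule.span_induction with
  | mem x hx =>
    obtain ⟨l, rfl, rfl⟩ := hx
    have : ∀ l : List (ZigzagGen n), ∀ h : (l.map (gen k)).prod ∈ gr k n N (l.map (deg N)).sum,
        decomp k n N (l.map (gen k)).prod =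
          DirectSum.of (fun i => gr k n N i) (l.map (deg N)).sum ⟨_, h⟩ := by
      intro l
      induction l with
      | nil =>
        intro h
        simp only [List.map_nil, List.prod_nil, map_one]
        exact of_eq k n N rfl rfl
      | cons g l ih =>
        intro h
        have h' : (l.map (gen k)).prod ∈ gr k n N (l.map (deg N)).sum :=
          Submodule.subset_span ⟨l, rfl, rfl⟩
        have e : (List.map (gen k) (g :: l)).prod = gen k g * (l.map (gen k)).prod := by simp
        refine (congrArg (decomp k n N) e).trans ?_
        rw [map_mul, decomp_gen, ih h', genD, DirectSum.of_mul_of]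
        exact of_eq k n N (by simp) e.symm
    exact this l _
  | zero => exact (map_zero _).trans (of_eq_zero k n N rfl).symm
  | add x y hx hy ihx ihy =>
    rw [map_add, ihx, ihy, ← map_add]
    rfl
  | smul c x hx ih =>
    rw [map_smul, ih]
    exact (map_smul (DirectSum.lof k ℤ (fun i => gr k n N i) i) c ⟨x, hx⟩).symm

theorem isInternal (N : ℕ) : DirectSum.IsInternal (gr k n N) := by
  let : GradedAlgebra (gr k n N) := GradedAlgebra.ofAlgHom _ (decomp k n N)
    (by
      apply RingQuot.ringQuot_ext'
      apply FreeAlgebra.hom_ext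
      funext g
      change DirectSum.coeAlgHom (gr k n N) (decomp k n N (gen k g)) = gen k g
      rw [decomp_gen, genD, DirectSum.coeAlgHom_of])
    (fun i x => decomp_of_mem k n N x)
  exact DirectSum.Decomposition.isInternal _

end Zigzag

/-- The zig-zag algebra `R_{n,N}` of the cyclic quiver `Γ_n`, as a graded algebra over `k^n`, with
its first (cohomological) grading. -/
abbrev zigzagAlgebra (k : Type u) [Field k] (n N : ℕ) [NeZero n] : GrAlg.{u, u} k (ZMod n) where
  carrier := Zigzag.Alg k n
  gr := Zigzag.gr k n N
  isInternal := Zigzag.isInternal k n N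
  e i := Zigzag.gen k (.vertex i)
  complete :=
    { idem := fun i => by
        have h' := Zigzag.rel k n (.idem i)
        simp only [Zigzag.fv, map_mul] at h'
        exact h'
      ortho := fun i j h => by
        have h' := Zigzag.rel k n (.ortho i j h)
        simp only [Zigzag.fv, map_mul, map_zero] at h'
        exact h'
      complete := by
        have h' := Zigzag.rel k n .one
        simp only [Zigzag.fv, map_sum, map_one] at h'
        exact h' }
  e_mem i := Zigzag.gen_mem k n N (.vertex i)

/-! A dg algebra is formal once it contains a sub dg algebra `S = T + J`, where `T` represents the
cohomology and `J` is an acyclic two-sided ideal of `S`: both maps in `C ← S → H(C)` are then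
quasi-isomorphisms (`isFormal_of_splitting`).

Such `T` and `J` exist for degree reasons (`isFormal_of_degrees`). Outside degrees `0` and `N` only
arrows contribute to the cohomology, and their degrees differ from `N/2` by at most `1/2`. Take for
`T` a bimodule complement of the coboundaries in the cocycles, with the idempotents in degree `0`.
Two composable classes of arrows multiply into degree at least `N - 1`, so `J` is needed only near
the top: everything above degree `N`, and a complement of `T` in degree `N`.

If `N` and `n` are odd, the alternation of the `d_i` breaks between the labels `n` and `1`, and two
arrows may have a nonzero product of degree `N - 1` in `C`. The span `W` of these products consists
of cocycles, and `H^{N-1} = 0`, so `W = d K` with `K` in degree `N - 2`; both are put into `J`. Then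
`J` can fail to be an ideal only through `T² K`, `K T²` and, for `N = 4`, `K K`. A nonzero component
of `K` lies over two composable arrows of total degree `N - 1`, so `T² K` or `K T²` would give three
composable arrows of total degree `N + 1`, whereas `deg_three_arrows` gives at least `N + 2`. For `N
= 4` two arrows have total degree `4`, so `W` and `K` vanish. -/

namespace DGAlg

variable {k : Type u} [Field k] {V : Type} [Fintype V] (C : DGAlg.{u, w} k V)

/-! ### Sub-bimodules over the ground ring -/

/-- A subspace is a sub-bimodule over `k^V` if it is stable under the idempotents. -/
def IsBimodule (U : Submodule k C.carrier) : Prop :=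
  ∀ v, ∀ x ∈ U, C.e v * x ∈ U ∧ x * C.e v ∈ U

variable {C}

theorem e_mul_e_self (v : V) : C.e v * C.e v = C.e v := C.complete.idem v

theorem e_mul_e_of_ne {v v' : V} (h : v ≠ v') : C.e v * C.e v' = 0 := C.complete.ortho h

theorem sum_e : ∑ v, C.e v = 1 := C.complete.complete

theorem d_e_mul (v : V) (x : C.carrier) : C.d (C.e v * x) = C.e v * C.d x := by
  simp [C.d_mul 0 _ x (C.e_mem v), C.d_e]

theorem d_mul_e (v : V) (x : C.carrier) : C.d (x * C.e v) = C.d x * C.e v :=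
  C.d_mul_of_right (C.d_e v) x

theorem mul_mem_gr {i j : ℤ} {x y : C.carrier} (hx : x ∈ C.gr i) (hy : y ∈ C.gr j) :
    x * y ∈ C.gr (i + j) :=
  SetLike.GradedMul.mul_mem (A := C.gr) hx hy

/-- The components of an element with respect to the idempotents sum up to the element. -/
theorem sum_peirce (x : C.carrier) : ∑ i, ∑ j, C.e i * x * C.e j = x := by
  simp_rw [← Finset.mul_sum, sum_e, mul_one, ← Finset.sum_mul, sum_e, one_mul]

theorem e_mul_peirce (i j : V) (x : C.carrier) :
    C.e i * (C.e i * x * C.e j) * C.e j = C.e i * x * C.e j := by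
  calc _ = (C.e i * C.e i) * x * (C.e j * C.e j) := by simp only [mul_assoc]
    _ = _ := by rw [e_mul_e_self, e_mul_e_self]

namespace IsBimodule

variable {U X Y : Submodule k C.carrier}

theorem inf (hU : C.IsBimodule U) (hX : C.IsBimodule X) : C.IsBimodule (U ⊓ X) :=
  fun v x hx => ⟨⟨(hU v x hx.1).1, (hX v x hx.2).1⟩, ⟨(hU v x hx.1).2, (hX v x hx.2).2⟩⟩

theorem sup (hU : C.IsBimodule U) (hX : C.IsBimodule X) : C.IsBimodule (U ⊔ X) := by
  intro v x hx
  obtain ⟨a, ha, b, hb, rfl⟩ := Submodule.mem_sup.1 hx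
  rw [mul_add, add_mul]
  exact ⟨Submodule.add_mem_sup (hU v a ha).1 (hX v b hb).1,
    Submodule.add_mem_sup (hU v a ha).2 (hX v b hb).2⟩

theorem bot : C.IsBimodule ⊥ := by
  intro v x hx
  rw [Submodule.mem_bot] at hx
  simp [hx]

theorem gr (i : ℤ) : C.IsBimodule (C.gr i) := fun v x hx =>
  ⟨by simpa using mul_mem_gr (C.e_mem v) hx, by simpa using mul_mem_gr hx (C.e_mem v)⟩

theorem ker_d : C.IsBimodule (LinearMap.ker C.d) := by
  intro v x hx
  rw [LinearMap.mem_ker] at hx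
  simp [d_e_mul, d_mul_e, hx]

theorem range_d : C.IsBimodule (LinearMap.range C.d) := by
  rintro v _ ⟨x, rfl⟩
  exact ⟨⟨C.e v * x, d_e_mul v x⟩, ⟨x * C.e v, d_mul_e v x⟩⟩

theorem comap_d (hU : C.IsBimodule U) : C.IsBimodule (U.comap C.d) := by
  intro v x hx
  rw [Submodule.mem_comap] at hx
  simp only [Submodule.mem_comap, d_e_mul, d_mul_e]
  exact hU v _ hx

theorem peirce_mem (hU : C.IsBimodule U) (i j : V) {x : C.carrier} (hx : x ∈ U) :
    C.e i * x * C.e j ∈ U :=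
  (hU j _ (hU i x hx).1).2

/-- An inclusion of subspaces may be checked on the components of a sub-bimodule. -/
theorem le_of_peirce (hX : C.IsBimodule X)
    (h : ∀ i j, ∀ x ∈ X, C.e i * x * C.e j = x → x ∈ U) : X ≤ U := by
  intro x hx
  rw [← sum_peirce x]
  exact Submodule.sum_mem _ fun i _ => Submodule.sum_mem _ fun j _ =>
    h i j _ (hX.peirce_mem i j hx) (e_mul_peirce i j x)

/-- Products of elements of sub-bimodules may be computed on composable components. -/
theorem mul_mem_of_peirce (hX : C.IsBimodule X) (hY : C.IsBimodule Y)
    (h : ∀ i j l, ∀ x ∈ X, ∀ y ∈ Y, C.e i * x * C.e j = x → C.e j * y * C.e l = y → x * y ∈ U)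
    {x y : C.carrier} (hx : x ∈ X) (hy : y ∈ Y) : x * y ∈ U := by
  have e1 : x * y = ∑ i, ∑ j, ∑ l, (C.e i * x * C.e j) * (C.e j * y * C.e l) := by
    have e2 : ∀ i j l, (C.e i * x * C.e j) * (C.e j * y * C.e l) =
        C.e i * x * C.e j * y * C.e l := by
      intro i j l
      calc _ = C.e i * x * (C.e j * C.e j) * y * C.e l := by simp only [mul_assoc]
        _ = _ := by rw [e_mul_e_self]
    simp_rw [e2, ← Finset.mul_sum, sum_e, mul_one, ← Finset.sum_mul, ← Finset.mul_sum, sum_e,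
      mul_one, ← Finset.sum_mul, sum_e, one_mul]
  rw [e1]
  exact Submodule.sum_mem _ fun i _ => Submodule.sum_mem _ fun j _ => Submodule.sum_mem _ fun l _ =>
    h i j l _ (hX.peirce_mem i j hx) _ (hY.peirce_mem j l hy) (e_mul_peirce i j x)
      (e_mul_peirce j l y)

/-- Sub-bimodules over the semisimple ring `k^V` have complements. -/
theorem exists_compl (hU : C.IsBimodule U) (hX : C.IsBimodule X) (h : U ≤ X) :
    ∃ T : Submodule k C.carrier, C.IsBimodule T ∧ T ≤ X ∧ Disjoint U T ∧ X ≤ U ⊔ T := by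
  classical
  obtain ⟨π, hπ⟩ := LinearMap.exists_leftInverse_of_injective U.subtype (Submodule.ker_subtype U)
  have hπU : ∀ x (hx : x ∈ U), (π x : C.carrier) = x := fun x hx =>
    congrArg Subtype.val (LinearMap.congr_fun hπ ⟨x, hx⟩)
  -- Applying the linear projection `π` block by block makes it a bimodule map, still the identity
  -- on `U`. Nothing is divided by, so the characteristic plays no role.
  let ρ : C.carrier →ₗ[k] C.carrier := ∑ i, ∑ j,
    LinearMap.mulRight k (C.e j) ∘ₗ LinearMap.mulLeft k (C.e i) ∘ₗ U.subtype ∘ₗ π ∘ₗ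
      LinearMap.mulRight k (C.e j) ∘ₗ LinearMap.mulLeft k (C.e i)
  have hρ : ∀ x, ρ x = ∑ i, ∑ j, C.e i * (π (C.e i * x * C.e j) : C.carrier) * C.e j := by
    intro x
    simp [ρ]
  have hρU : ∀ x, ρ x ∈ U := by
    intro x
    rw [hρ]
    exact Submodule.sum_mem _ fun i _ => Submodule.sum_mem _ fun j _ =>
      hU.peirce_mem i j (SetLike.coe_mem _)
  have hρid : ∀ x ∈ U, ρ x = x := by
    intro x hx
    rw [hρ]
    conv_rhs => rw [← sum_peirce x]
    refine Finset.sum_congr rfl fun i _ => Finset.sum_congr rfl fun j _ => ?_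
    rw [hπU _ (hU.peirce_mem i j hx), e_mul_peirce]
  have left : ∀ v x, ρ (C.e v * x) = C.e v * ρ x := by
    intro v x
    simp only [hρ, Finset.mul_sum]
    refine Finset.sum_congr rfl fun i _ => Finset.sum_congr rfl fun j _ => ?_
    by_cases hi : v = i
    · subst hi
      simp only [← mul_assoc, e_mul_e_self]
    · simp only [← mul_assoc, e_mul_e_of_ne hi, e_mul_e_of_ne (Ne.symm hi), zero_mul, map_zero,
        ZeroMemClass.coe_zero, mul_zero]
  have right : ∀ v x, ρ (x * C.e v) = ρ x * C.e v := by
    intro v x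
    simp only [hρ, Finset.sum_mul]
    refine Finset.sum_congr rfl fun i _ => Finset.sum_congr rfl fun j _ => ?_
    by_cases hj : v = j
    · subst hj
      simp only [mul_assoc, e_mul_e_self]
    · simp only [mul_assoc, e_mul_e_of_ne hj, e_mul_e_of_ne (Ne.symm hj), zero_mul, map_zero,
        ZeroMemClass.coe_zero, mul_zero]
  refine ⟨X ⊓ LinearMap.ker ρ, hX.inf ?_, inf_le_left, ?_, ?_⟩
  · intro v x hx
    rw [LinearMap.mem_ker] at hx
    simp [left, right, hx]
  · rw [Submodule.disjoint_def]
    rintro x hx ⟨-, hx'⟩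
    rw [← hρid x hx]
    exact hx'
  · intro x hx
    rw [← add_sub_cancel (ρ x) x]
    refine Submodule.add_mem_sup (hρU x) ⟨X.sub_mem hx (h (hρU x)), ?_⟩
    change ρ (x - ρ x) = 0
    rw [map_sub, hρid _ (hρU x), sub_self]

end IsBimodule

/-! ### Graded subspaces -/

variable (C) in
/-- The graded subspace with given homogeneous parts. -/
noncomputable def total (F : ℤ → Submodule k C.carrier) : Submodule k C.carrier :=
  ⨅ p, (F p).comap (C.proj p)

theorem mem_total {F : ℤ → Submodule k C.carrier} {x : C.carrier} :
    x ∈ C.total F ↔ ∀ p, C.proj p x ∈ F p := by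
  simp [total]

theorem mem_total_of_mem {F : ℤ → Submodule k C.carrier} {p : ℤ} {x : C.carrier}
    (hx : x ∈ C.gr p) (h : x ∈ F p) : x ∈ C.total F := by
  rw [mem_total]
  intro q
  by_cases hq : p = q
  · subst hq
    rwa [C.proj_same hx]
  · rw [C.proj_ne hx hq]
    exact Submodule.zero_mem _

theorem mul_mem_total {F G E : ℤ → Submodule k C.carrier}
    (h : ∀ p q, ∀ x ∈ F p, ∀ y ∈ G q, x * y ∈ E (p + q)) {x y : C.carrier}
    (hx : x ∈ C.total F) (hy : y ∈ C.total G) : x * y ∈ C.total E := by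
  obtain ⟨s, hs⟩ := C.sum_proj x
  obtain ⟨t, ht⟩ := C.sum_proj y
  rw [hs, ht, Finset.sum_mul_sum]
  exact Submodule.sum_mem _ fun p _ => Submodule.sum_mem _ fun q _ =>
    mem_total_of_mem (mul_mem_gr (C.proj_mem p x) (C.proj_mem q y))
      (h p q _ (mem_total.1 hx p) _ (mem_total.1 hy q))

theorem d_mem_total {F G : ℤ → Submodule k C.carrier}
    (h : ∀ p, ∀ x ∈ F p, C.d x ∈ G (p + 1)) {x : C.carrier}
    (hx : x ∈ C.total F) : C.d x ∈ C.total G := by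
  obtain ⟨s, hs⟩ := C.sum_proj x
  rw [hs, map_sum]
  exact Submodule.sum_mem _ fun p _ =>
    mem_total_of_mem (C.d_mem _ _ (C.proj_mem p x)) (h p _ (mem_total.1 hx p))

/-! ### Sub dg algebras -/

/-- A graded subalgebra that contains the ground ring and is stable under the differential, as a
differential graded algebra. -/
@[reducible]
noncomputable def sub (S : Subalgebra k C.carrier) (hproj : ∀ p, ∀ x ∈ S, C.proj p x ∈ S)
    (hd : ∀ x ∈ S, C.d x ∈ S) (he : ∀ v, C.e v ∈ S) : DGAlg.{u, w} k V where
  carrier := S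
  gr i := (C.gr i).comap S.val.toLinearMap
  gradedMonoid :=
    { one_mem := SetLike.GradedOne.one_mem (A := C.gr)
      mul_mem := fun _ _ _ _ hx hy => mul_mem_gr (C := C) hx hy }
  isInternal := by
    rw [DirectSum.isInternal_submodule_iff_iSupIndep_and_iSup_eq_top]
    constructor
    · intro i
      rw [Submodule.disjoint_def]
      intro x hx hx'
      have h : ⨆ j, ⨆ (_ : j ≠ i), (C.gr j).comap S.val.toLinearMap ≤
          LinearMap.ker (C.proj i ∘ₗ S.val.toLinearMap) :=
        iSup_le fun j => iSup_le fun hj y hy => C.proj_ne hy hj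
      have h1 : C.proj i x = 0 := h hx'
      exact Subtype.ext ((C.proj_same hx).symm.trans h1)
    · rw [eq_top_iff]
      rintro x -
      obtain ⟨s, hs⟩ := C.sum_proj x
      have : x = ∑ i ∈ s, (⟨C.proj i x, hproj i x x.2⟩ : S) := by
        apply Subtype.ext
        rw [AddSubmonoidClass.coe_finsetSum]
        exact hs
      rw [this]
      exact Submodule.sum_mem _ fun i _ => Submodule.mem_iSup_of_mem i (C.proj_mem i _)
  e v := ⟨C.e v, he v⟩
  complete :=
    { idem := fun v => Subtype.ext (C.complete.idem v)
      ortho := fun v v' hv => Subtype.ext (C.complete.ortho hv)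
      complete := Subtype.ext (by
        rw [AddSubmonoidClass.coe_finsetSum]
        exact C.complete.complete) }
  e_mem v := C.e_mem v
  d := (C.d ∘ₗ S.val.toLinearMap).codRestrict S.toSubmodule fun x => hd x x.2
  d_mem i x hx := C.d_mem i x hx
  d_d x := Subtype.ext (C.d_d x)
  d_mul i x y hx := Subtype.ext (by
    refine (C.d_mul i x y hx).trans ?_
    -- Once the sign is known to be `1` or `-1`, it passes through the inclusion of `S`.
    obtain h | h := Int.units_eq_one_or i.negOnePow <;> rw [h] <;> simp <;> rfl)
  d_e v := Subtype.ext (C.d_e v)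

/-- Injectivity and surjectivity on cohomology, unwound to cochains; both legs of the roof in
`isFormal_of_splitting` are tested in this form. -/
theorem Hom.isQuasiIso_iff {C D : DGAlg.{u, w} k V} (f : Hom C D) :
    f.IsQuasiIso ↔ (∀ x, C.d x = 0 → (∃ y, D.d y = f.toAlgHom x) → ∃ y, C.d y = x) ∧
      ∀ z, D.d z = 0 → ∃ x, C.d x = 0 ∧ ∃ y, D.d y = z - f.toAlgHom x := by
  have key : ∀ x : C.cocycles, f.mapH (C.cls x) = D.cls (f.mapCocycles x) := fun x => rfl
  constructor
  · rintro ⟨hinj, hsurj⟩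
    constructor
    · intro x hx hy
      have h0 : f.mapH (C.cls ⟨x, hx⟩) = 0 := by
        rw [key]
        exact D.cls_eq_zero.2 hy
      exact C.cls_eq_zero.1 ((injective_iff_map_eq_zero f.mapH).1 hinj _ h0)
    · intro z hz
      obtain ⟨a, ha⟩ := hsurj (D.cls ⟨z, hz⟩)
      obtain ⟨x, rfl⟩ := C.cls_surjective a
      refine ⟨x, x.2, ?_⟩
      have h0 : D.cls (⟨z, hz⟩ - f.mapCocycles x) = 0 := by
        rw [map_sub, ← ha, key]
        exact sub_self _
      exact D.cls_eq_zero.1 h0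
  · rintro ⟨h1, h2⟩
    constructor
    · rw [injective_iff_map_eq_zero]
      intro a ha
      obtain ⟨x, rfl⟩ := C.cls_surjective a
      rw [key] at ha
      exact C.cls_eq_zero.2 (h1 x x.2 (D.cls_eq_zero.1 ha))
    · intro b
      obtain ⟨z, rfl⟩ := D.cls_surjective b
      obtain ⟨x, hx, hy⟩ := h2 z z.2
      refine ⟨C.cls ⟨x, hx⟩, ?_⟩
      have h0 : D.cls (z - f.mapCocycles ⟨x, hx⟩) = 0 := D.cls_eq_zero.2 hy
      rw [map_sub] at h0
      rw [key]
      exact (sub_eq_zero.1 h0).symm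

/-! ### A criterion for formality -/

theorem total_le {F : ℤ → Submodule k C.carrier} {U : Submodule k C.carrier}
    (h : ∀ p, ∀ x ∈ C.gr p, x ∈ F p → x ∈ U) : C.total F ≤ U := by
  intro x hx
  obtain ⟨s, hs⟩ := C.sum_proj x
  rw [hs]
  exact Submodule.sum_mem _ fun p _ => h p _ (C.proj_mem p x) (mem_total.1 hx p)

/-- A criterion for formality: if the cocycles contain representatives `T` of the cohomology that
are closed under multiplication up to an acyclic graded subspace `J`, which is stable under
multiplication with `T` and `J`, then the algebra is formal. -/
theorem isFormal_of_splitting (T J : ℤ → Submodule k C.carrier)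
    (hT : ∀ p, T p ≤ C.gr p) (hJ : ∀ p, J p ≤ C.gr p)
    (hTd : ∀ p, ∀ x ∈ T p, C.d x = 0)
    (hTB : ∀ p, ∀ x ∈ T p, (∃ y, C.d y = x) → x = 0)
    (hZ : ∀ p, ∀ x ∈ C.gr p, C.d x = 0 → ∃ t ∈ T p, ∃ y, C.d y = x - t)
    (hJd : ∀ p, ∀ x ∈ J p, C.d x ∈ J (p + 1))
    (hJZ : ∀ p, ∀ x ∈ J p, C.d x = 0 → ∃ y ∈ J (p - 1), C.d y = x)
    (he : ∀ v, C.e v ∈ T 0)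
    (hTT : ∀ p q, ∀ x ∈ T p, ∀ y ∈ T q, x * y ∈ T (p + q) ⊔ J (p + q))
    (hTJ : ∀ p q, ∀ x ∈ T p, ∀ y ∈ J q, x * y ∈ J (p + q))
    (hJT : ∀ p q, ∀ x ∈ J p, ∀ y ∈ T q, x * y ∈ J (p + q))
    (hJJ : ∀ p q, ∀ x ∈ J p, ∀ y ∈ J q, x * y ∈ J (p + q)) : C.IsFormal := by
  have hSJ : ∀ p q, ∀ x ∈ T p ⊔ J p, ∀ y ∈ J q, x * y ∈ J (p + q) := by
    intro p q x hx y hy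
    obtain ⟨a, ha, b, hb, rfl⟩ := Submodule.mem_sup.1 hx
    rw [add_mul]
    exact Submodule.add_mem _ (hTJ p q a ha y hy) (hJJ p q b hb y hy)
  have hJS : ∀ p q, ∀ x ∈ J p, ∀ y ∈ T q ⊔ J q, x * y ∈ J (p + q) := by
    intro p q x hx y hy
    obtain ⟨a, ha, b, hb, rfl⟩ := Submodule.mem_sup.1 hy
    rw [mul_add]
    exact Submodule.add_mem _ (hJT p q x hx a ha) (hJJ p q x hx b hb)
  have hSS : ∀ p q, ∀ x ∈ T p ⊔ J p, ∀ y ∈ T q ⊔ J q, x * y ∈ T (p + q) ⊔ J (p + q) := by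
    intro p q x hx y hy
    obtain ⟨a, ha, b, hb, rfl⟩ := Submodule.mem_sup.1 hy
    rw [mul_add]
    refine Submodule.add_mem _ ?_ (Submodule.mem_sup_right (hSJ p q x hx b hb))
    obtain ⟨a', ha', b', hb', rfl⟩ := Submodule.mem_sup.1 hx
    rw [add_mul]
    exact Submodule.add_mem _ (hTT p q a' ha' a ha) (Submodule.mem_sup_right (hJT p q b' hb' a ha))
  have one_mem_T : (1 : C.carrier) ∈ T 0 := by
    rw [← sum_e]
    exact Submodule.sum_mem _ fun v _ => he v
  let S : Subalgebra k C.carrier :=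
    (C.total fun p => T p ⊔ J p).toSubalgebra
      (mem_total_of_mem SetLike.GradedOne.one_mem (Submodule.mem_sup_left one_mem_T))
      fun x y hx hy => mul_mem_total hSS hx hy
  have mem_S : ∀ x, x ∈ S ↔ x ∈ C.total fun p => T p ⊔ J p := fun x => Iff.rfl
  have T_le : C.total T ≤ C.total fun p => T p ⊔ J p := total_le fun p x hx hx' =>
    mem_total_of_mem hx (Submodule.mem_sup_left hx')
  have J_le : C.total J ≤ C.total fun p => T p ⊔ J p := total_le fun p x hx hx' =>
    mem_total_of_mem hx (Submodule.mem_sup_right hx')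
  have T_cocycle : C.total T ≤ LinearMap.ker C.d := total_le fun p x _ hx => hTd p x hx
  have T_boundary : ∀ x ∈ C.total T, (∃ y, C.d y = x) → x = 0 := by
    rintro x hx ⟨y, hy⟩
    obtain ⟨s, hs⟩ := C.sum_proj x
    rw [hs]
    refine Finset.sum_eq_zero fun p _ => hTB p _ (mem_total.1 hx p) ⟨C.proj (p - 1) y, ?_⟩
    rw [← proj_d, hy, sub_add_cancel]
  have J_boundary : ∀ x ∈ C.total J, C.d x = 0 → ∃ y ∈ C.total J, C.d y = x := by
    intro x hx hdx
    obtain ⟨s, hs⟩ := C.sum_proj x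
    have : x ∈ (C.total J).map C.d := by
      rw [hs]
      refine Submodule.sum_mem _ fun p _ => ?_
      obtain ⟨y, hy, hyx⟩ := hJZ p _ (mem_total.1 hx p) (by rw [← proj_d, hdx, map_zero])
      exact ⟨y, mem_total_of_mem (hJ _ hy) hy, hyx⟩
    simpa using this
  have J_d : ∀ x ∈ C.total J, C.d x ∈ C.total J := fun x hx => d_mem_total hJd hx
  have split : ∀ x ∈ S, ∃ z ∈ C.total T, x - z ∈ C.total J := by
    intro x hx
    have : x ∈ C.total T ⊔ C.total J := by
      refine total_le (U := C.total T ⊔ C.total J) ?_ hx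
      intro p y hy hy'
      obtain ⟨a, ha, b, hb, rfl⟩ := Submodule.mem_sup.1 hy'
      exact Submodule.add_mem_sup (mem_total_of_mem (hT p ha) ha) (mem_total_of_mem (hJ p hb) hb)
    obtain ⟨a, ha, b, hb, rfl⟩ := Submodule.mem_sup.1 this
    exact ⟨a, ha, by simpa using hb⟩
  have cocycle_split : ∀ z, C.d z = 0 → ∃ t ∈ C.total T, ∃ y, C.d y = z - t := by
    intro z hz
    obtain ⟨s, hs⟩ := C.sum_proj z
    have : z ∈ C.total T ⊔ LinearMap.range C.d := by
      rw [hs]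
      refine Submodule.sum_mem _ fun p _ => ?_
      obtain ⟨t, ht, y, hy⟩ := hZ p _ (C.proj_mem p z) (by rw [← proj_d, hz, map_zero])
      rw [← add_sub_cancel t (C.proj p z)]
      exact Submodule.add_mem_sup (mem_total_of_mem (hT p ht) ht) ⟨y, hy⟩
    obtain ⟨a, ha, _, ⟨y, rfl⟩, rfl⟩ := Submodule.mem_sup.1 this
    exact ⟨a, ha, y, by simp⟩
  -- The choice `r` need not be linear or multiplicative; only the class of `r x` matters, and
  -- `uniq` shows that it depends on `x` modulo `J` alone.
  choose r hrT hrJ using fun x : S => split x x.2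
  have hrd : ∀ x, C.d (r x) = 0 := fun x => T_cocycle (hrT x)
  have J_cls : ∀ z : C.cocycles, (z : C.carrier) ∈ C.total J → C.cls z = 0 := fun z hz =>
    C.cls_eq_zero.2 (let ⟨y, _, hy⟩ := J_boundary _ hz z.2; ⟨y, hy⟩)
  have uniq : ∀ (x : S) (z : C.cocycles), (x : C.carrier) - z ∈ C.total J →
      C.cls ⟨r x, hrd x⟩ = C.cls z := by
    intro x z hz
    have h0 := J_cls (⟨r x, hrd x⟩ - z) (by
      have := Submodule.sub_mem _ hz (hrJ x)
      simpa using this)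
    rw [map_sub] at h0
    exact sub_eq_zero.1 h0
  have boundary_r : ∀ x : S, C.d x = 0 → (∃ y, C.d y = r x) → ∃ y ∈ C.total J, C.d y = x := by
    intro x hx hy
    have := hrJ x
    rw [T_boundary _ (hrT x) hy, sub_zero] at this
    exact J_boundary _ this hx
  have he' : ∀ v, C.e v ∈ S := fun v => T_le (mem_total_of_mem (C.e_mem v) (he v))
  let φ : S →ₐ[k] C.H :=
    { toFun := fun x => C.cls ⟨r x, hrd x⟩
      map_one' := by
        rw [uniq 1 1 (by simp), map_one]
      map_mul' := fun x y => by
        rw [← map_mul]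
        refine uniq _ _ ?_
        -- Multiplicativity modulo `J` is the ideal property of `J` in `S`.
        have : ((x * y : S) : C.carrier) - r x * r y =
            x * (y - r y) + (x - r x) * r y := by
          simp only [MulMemClass.coe_mul]
          noncomm_ring
        change ((x * y : S) : C.carrier) - r x * r y ∈ C.total J
        rw [this]
        exact Submodule.add_mem _ (mul_mem_total hSJ x.2 (hrJ y))
          (mul_mem_total hJT (hrJ x) (hrT y))
      map_zero' := by
        rw [uniq 0 0 (by simp), map_zero]
      map_add' := fun x y => by
        rw [← map_add]
        refine uniq _ _ ?_
        change ((x + y : S) : C.carrier) - (r x + r y) ∈ C.total J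
        have : ((x + y : S) : C.carrier) - (r x + r y) = (x - r x) + (y - r y) := by
          simp only [AddMemClass.coe_add]
          abel
        rw [this]
        exact Submodule.add_mem _ (hrJ x) (hrJ y)
      commutes' := fun c => by
        rw [uniq _ (algebraMap k C.cocycles c) (by simp), AlgHom.commutes] }
  have hφ : ∀ (x : S) (z : C.cocycles), (x : C.carrier) - z ∈ C.total J → φ x = C.cls z := uniq
  have hd : ∀ x ∈ S, C.d x ∈ C.total J := by
    intro x hx
    have := J_d _ (hrJ ⟨x, hx⟩)
    rwa [map_sub, hrd, sub_zero] at this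
  let D : DGAlg.{u, w} k V := C.sub S
    (fun p x hx => mem_total_of_mem (C.proj_mem p x) (mem_total.1 hx p))
    (fun x hx => J_le (hd x hx)) he'
  have hDd : ∀ x : S, ((D.d x : S) : C.carrier) = C.d x := fun x => rfl
  let f : Hom D C :=
    { toAlgHom := S.val
      map_gr := fun i x hx => hx
      map_d := fun x => rfl
      map_e := fun v => rfl }
  let g : Hom D C.cohomology.toDGAlg :=
    { toAlgHom := φ
      map_gr := fun i x hx => by
        have hx : (x : C.carrier) ∈ C.gr i := hx
        -- The choice of `r` records no homogeneity, so its component of degree `i` serves as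
        -- representative.
        have hz : C.d (C.proj i (r x)) = 0 := by rw [← proj_d, hrd, map_zero]
        refine C.mem_Hgr.2 ⟨⟨C.proj i (r x), hz⟩, C.proj_mem _ _, (hφ x _ ?_).symm⟩
        change (x : C.carrier) - C.proj i (r x) ∈ C.total J
        have := mem_total.1 (hrJ x) i
        rw [map_sub, C.proj_same hx] at this
        exact mem_total_of_mem (Submodule.sub_mem _ hx (C.proj_mem _ _)) this
      map_d := fun x => by
        change φ (D.d x) = 0
        rw [hφ _ 0 (by simpa [hDd] using hd x x.2), map_zero]
      map_e := fun v => hφ _ ⟨C.e v, C.d_e v⟩ (by simp [D]) }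
  have hf : f.IsQuasiIso := by
    rw [Hom.isQuasiIso_iff]
    constructor
    · rintro x hx ⟨y, hy⟩
      have hx : C.d x = 0 := congrArg Subtype.val hx
      have hy : C.d y = x := hy
      -- If `x` bounds in `C`, so does `r x`, because `x - r x` bounds in `J`; as `T` meets the
      -- coboundaries trivially, `r x = 0` and `x` bounds inside `J`.
      obtain ⟨j, hj, hjx⟩ := J_boundary _ (hrJ x) (by rw [map_sub, hx, hrd, sub_zero])
      obtain ⟨a, ha, hax⟩ := boundary_r x hx ⟨y - j, by rw [map_sub, hy, hjx, sub_sub_cancel]⟩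
      exact ⟨⟨a, J_le ha⟩, Subtype.ext hax⟩
    · intro z hz
      obtain ⟨t, ht, y, hy⟩ := cocycle_split z hz
      exact ⟨⟨t, T_le ht⟩, Subtype.ext (T_cocycle ht), y, hy⟩
  have hg : g.IsQuasiIso := by
    rw [Hom.isQuasiIso_iff]
    constructor
    · rintro x hx ⟨y, hy⟩
      have hx : C.d x = 0 := congrArg Subtype.val hx
      have hy : 0 = C.cls ⟨r x, hrd x⟩ := hy
      obtain ⟨a, ha, hax⟩ := boundary_r x hx (C.cls_eq_zero.1 hy.symm)
      exact ⟨⟨a, J_le ha⟩, Subtype.ext hax⟩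
    · intro z hz
      obtain ⟨c, rfl⟩ := C.cls_surjective z
      obtain ⟨t, ht, y, hy⟩ := cocycle_split c c.2
      refine ⟨⟨t, T_le ht⟩, Subtype.ext (T_cocycle ht), 0, ?_⟩
      have h1 : φ ⟨t, T_le ht⟩ = C.cls ⟨t, T_cocycle ht⟩ := hφ _ _ (by simp)
      have h2 : C.cls (c - ⟨t, T_cocycle ht⟩) = 0 := C.cls_eq_zero.2 ⟨y, hy⟩
      rw [map_sub] at h2
      change 0 = C.cls c - φ ⟨t, T_le ht⟩
      rw [h1]
      exact h2.symm
  exact Relation.EqvGen.trans _ _ _ (Relation.EqvGen.symm _ _ (Relation.EqvGen.rel _ _ ⟨f, hf⟩))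
    (Relation.EqvGen.rel _ _ ⟨g, hg⟩)

/-! ### Formality for degree reasons -/

theorem IsBimodule.span_e_mul {U : Submodule k C.carrier} (hU : C.IsBimodule U) {x y : C.carrier}
    (hx : x ∈ Submodule.span k (Set.range C.e)) (hy : y ∈ U) : x * y ∈ U ∧ y * x ∈ U := by
  induction hx using Submodule.span_induction with
  | mem x hx =>
    obtain ⟨v, rfl⟩ := hx
    exact hU v y hy
  | zero => simp
  | add a b _ _ ha hb =>
    rw [add_mul, mul_add]
    exact ⟨U.add_mem ha.1 hb.1, U.add_mem ha.2 hb.2⟩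
  | smul c a _ ha =>
    rw [smul_mul_assoc, mul_smul_comm]
    exact ⟨U.smul_mem c ha.1, U.smul_mem c ha.2⟩

theorem exists_smul_e_of_mem_span {x : C.carrier} (hx : x ∈ Submodule.span k (Set.range C.e))
    (v : V) : ∃ c : k, C.e v * x = c • C.e v ∧ x * C.e v = c • C.e v := by
  induction hx using Submodule.span_induction with
  | mem x hx =>
    obtain ⟨i, rfl⟩ := hx
    by_cases h : v = i
    · subst h
      exact ⟨1, by simp [e_mul_e_self]⟩
    · exact ⟨0, by simp [e_mul_e_of_ne h, e_mul_e_of_ne (Ne.symm h)]⟩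
  | zero => exact ⟨0, by simp⟩
  | add a b _ _ ha hb =>
    obtain ⟨c, hc, hc'⟩ := ha
    obtain ⟨c', hb, hb'⟩ := hb
    exact ⟨c + c', by rw [mul_add, hc, hb, add_smul], by rw [add_mul, hc', hb', add_smul]⟩
  | smul c a _ ha =>
    obtain ⟨c', hc, hc'⟩ := ha
    exact ⟨c * c', by rw [mul_smul_comm, hc, smul_smul], by rw [smul_mul_assoc, hc', smul_smul]⟩

theorem isBimodule_span_e : C.IsBimodule (Submodule.span k (Set.range C.e)) := by
  intro v x hx
  obtain ⟨c, h, h'⟩ := exists_smul_e_of_mem_span hx v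
  rw [h, h']
  have := Submodule.smul_mem _ c (Submodule.subset_span (R := k) (Set.mem_range_self (f := C.e) v))
  exact ⟨this, this⟩

/-- If no idempotent is a coboundary, then the idempotents are independent modulo coboundaries. -/
theorem eq_zero_of_mem_span_e (h : ∀ v, ¬∃ y, C.d y = C.e v) {x : C.carrier}
    (hx : x ∈ Submodule.span k (Set.range C.e)) (hx' : ∃ y, C.d y = x) : x = 0 := by
  obtain ⟨y, rfl⟩ := hx'
  rw [← one_mul (C.d y), ← sum_e, Finset.sum_mul]
  refine Finset.sum_eq_zero fun v _ => ?_
  obtain ⟨c, hc, -⟩ := exists_smul_e_of_mem_span hx v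
  by_cases hc0 : c = 0
  · rw [hc, hc0, zero_smul]
  · refine absurd ⟨c⁻¹ • (C.e v * y), ?_⟩ (h v)
    rw [map_smul, d_e_mul, hc, smul_smul, inv_mul_cancel₀ hc0, one_smul]

/-- A degree criterion for formality. The relation `P i j p` bounds the nonzero components of the
cohomology in degrees `p` other than `0` and `N`. -/
theorem isFormal_of_degrees {N : ℤ} (hN : 4 ≤ N) (P : V → V → ℤ → Prop)
    (hP : ∀ i j p, P i j p → 2 ≤ p ∧ p ≤ N - 2)
    (hP2 : ∀ i j l p q, P i j p → P j l q → N - 1 ≤ p + q)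
    (hP3 : ∀ i j l m p q r, P i j p → P j l q → P l m r → N + 2 ≤ p + q + r)
    (h : ∀ i j p, p ≠ 0 → p ≠ N → ∀ x ∈ C.gr p, C.d x = 0 → C.e i * x * C.e j = x →
      (¬∃ y, C.d y = x) → P i j p)
    (h0 : ∀ x ∈ C.gr 0, C.d x = 0 →
      ∃ t ∈ Submodule.span k (Set.range C.e), ∃ y, C.d y = x - t)
    (he : ∀ v, ¬∃ y, C.d y = C.e v) : C.IsFormal := by
  have span_gr : Submodule.span k (Set.range C.e) ≤ C.gr 0 := by
    rw [Submodule.span_le]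
    rintro _ ⟨v, rfl⟩
    exact C.e_mem v
  have span_d : Submodule.span k (Set.range C.e) ≤ LinearMap.ker C.d := by
    rw [Submodule.span_le]
    rintro _ ⟨v, rfl⟩
    exact C.d_e v
  -- In degree `0` an arbitrary complement will not do: `T 0` must contain the unit and act on every
  -- bimodule, hence the span of the idempotents.
  have hTex : ∀ p, ∃ T : Submodule k C.carrier, C.IsBimodule T ∧ T ≤ C.gr p ∧
      (∀ x ∈ T, C.d x = 0) ∧ (∀ x ∈ T, (∃ y, C.d y = x) → x = 0) ∧
      (∀ x ∈ C.gr p, C.d x = 0 → ∃ t ∈ T, ∃ y, C.d y = x - t) ∧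
      (p = 0 → T = Submodule.span k (Set.range C.e)) := by
    intro p
    by_cases hp : p = 0
    · subst hp
      exact ⟨_, isBimodule_span_e, span_gr, fun x hx => span_d hx,
        fun x hx => eq_zero_of_mem_span_e he hx, h0, fun _ => rfl⟩
    · obtain ⟨T, hT, hTX, hdis, hle⟩ := IsBimodule.exists_compl
        (IsBimodule.inf IsBimodule.range_d (IsBimodule.inf (IsBimodule.gr (C := C) p)
          IsBimodule.ker_d))
        (IsBimodule.inf (IsBimodule.gr (C := C) p) IsBimodule.ker_d) inf_le_right
      refine ⟨T, hT, hTX.trans inf_le_left, fun x hx => (hTX hx).2, fun x hx hy => ?_,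
        fun x hx hdx => ?_, fun h => absurd h hp⟩
      · exact Submodule.disjoint_def.1 hdis x ⟨hy, hTX hx⟩ hx
      · obtain ⟨_, ⟨⟨y, rfl⟩, -⟩, t, ht, rfl⟩ := Submodule.mem_sup.1 (hle ⟨hx, hdx⟩)
        exact ⟨t, ht, y, by simp⟩
  choose T hTbi hTgr hTd hTB hTZ hT0 using hTex
  -- The complement `D p` of the cocycles is mapped by `d` isomorphically onto the coboundaries of
  -- degree `p + 1`.
  have hDex : ∀ p, ∃ D : Submodule k C.carrier, C.IsBimodule D ∧ D ≤ C.gr p ∧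
      (∀ x ∈ D, C.d x = 0 → x = 0) ∧ (∀ x ∈ C.gr p, ∃ y ∈ D, C.d (x - y) = 0) := by
    intro p
    obtain ⟨D, hD, hDX, hdis, hle⟩ := IsBimodule.exists_compl
      (IsBimodule.inf (IsBimodule.gr (C := C) p) IsBimodule.ker_d) (IsBimodule.gr (C := C) p)
      inf_le_left
    refine ⟨D, hD, hDX, fun x hx hdx => ?_, fun x hx => ?_⟩
    · exact Submodule.disjoint_def.1 hdis x ⟨hDX hx, hdx⟩ hx
    · obtain ⟨a, ⟨-, ha⟩, y, hy, rfl⟩ := Submodule.mem_sup.1 (hle hx)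
      exact ⟨y, hy, by simpa using ha⟩
  choose D hDbi hDgr hD0 hDZ using hDex
  have hTP : ∀ i j p, p ≠ 0 → p ≠ N → ∀ x ∈ T p, C.e i * x * C.e j = x → x ≠ 0 → P i j p :=
    fun i j p hp hpN x hx hx' hx0 => h i j p hp hpN x (hTgr p hx) (hTd p x hx) hx'
      fun hy => hx0 (hTB p x hx hy)
  have T_zero : ∀ p, p ≠ 0 → p ≠ N → ¬(2 ≤ p ∧ p ≤ N - 2) → ∀ x ∈ T p, x = 0 := by
    intro p hp hpN hp' x hx
    refine (Submodule.mem_bot k).1 ((hTbi p).le_of_peirce (U := ⊥) (fun i j y hy hy' => ?_) hx)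
    by_contra hy0
    exact hp' (hP i j p (hTP i j p hp hpN y hy hy' hy0))
  have exact_d : ∀ p, p ≠ 0 → p ≠ N → ¬(2 ≤ p ∧ p ≤ N - 2) → ∀ x ∈ C.gr p, C.d x = 0 →
      ∃ y ∈ C.gr (p - 1), C.d y = x := by
    intro p hp hpN hp' x hx hdx
    obtain ⟨t, ht, y, hy⟩ := hTZ p x hx hdx
    rw [T_zero p hp hpN hp' t ht, sub_zero] at hy
    refine ⟨C.proj (p - 1) y, C.proj_mem _ _, ?_⟩
    rw [← proj_d, sub_add_cancel, hy, C.proj_same hx]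
  -- The products of degree `N - 1` are coboundaries that need not vanish; they are the obstruction
  -- to a plain truncation.
  let W : Submodule k C.carrier := Submodule.span k
    {z | ∃ p q, p ≠ 0 ∧ p ≠ N ∧ q ≠ 0 ∧ q ≠ N ∧ p + q = N - 1 ∧ ∃ x ∈ T p, ∃ y ∈ T q, x * y = z}
  have W_le : ∀ U : Submodule k C.carrier, (∀ p q, p ≠ 0 → p ≠ N → q ≠ 0 → q ≠ N →
      p + q = N - 1 → ∀ x ∈ T p, ∀ y ∈ T q, x * y ∈ U) → W ≤ U := by
    intro U hU
    refine Submodule.span_le.2 ?_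
    rintro _ ⟨p, q, hp, hpN, hq, hqN, hpq, x, hx, y, hy, rfl⟩
    exact hU p q hp hpN hq hqN hpq x hx y hy
  have mul_mem_W : ∀ p q, p ≠ 0 → p ≠ N → q ≠ 0 → q ≠ N → p + q = N - 1 →
      ∀ x ∈ T p, ∀ y ∈ T q, x * y ∈ W := fun p q hp hpN hq hqN hpq x hx y hy =>
    Submodule.subset_span ⟨p, q, hp, hpN, hq, hqN, hpq, x, hx, y, hy, rfl⟩
  have W_gr : W ≤ C.gr (N - 1) := W_le _ fun p q _ _ _ _ hpq x hx y hy => by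
    rw [← hpq]
    exact mul_mem_gr (hTgr p hx) (hTgr q hy)
  have W_d : W ≤ LinearMap.ker C.d := W_le _ fun p q _ _ _ _ _ x hx y hy => by
    rw [LinearMap.mem_ker, C.d_mul_of_right (hTd q y hy), hTd p x hx, zero_mul]
  have W_bi : C.IsBimodule W := by
    intro v x hx
    constructor
    · refine W_le (W.comap (LinearMap.mulLeft k (C.e v)))
        (fun p q hp hpN hq hqN hpq x hx y hy => ?_) hx
      simp only [Submodule.mem_comap, LinearMap.mulLeft_apply, ← mul_assoc]
      exact mul_mem_W p q hp hpN hq hqN hpq _ (hTbi p v x hx).1 y hy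
    · refine W_le (W.comap (LinearMap.mulRight k (C.e v)))
        (fun p q hp hpN hq hqN hpq x hx y hy => ?_) hx
      simp only [Submodule.mem_comap, LinearMap.mulRight_apply, mul_assoc]
      exact mul_mem_W p q hp hpN hq hqN hpq x hx _ (hTbi q v y hy).2
  have W_path : ∀ i l, ∀ w ∈ W, C.e i * w * C.e l = w → w ≠ 0 →
      ∃ j p q, P i j p ∧ P j l q ∧ p + q = N - 1 := by
    intro i l w hw hw' hw0
    by_contra hno
    -- Without such a pair of arrows, every generator of `W` has zero component from `i` to `l`.
    have hW : W ≤ LinearMap.ker (LinearMap.mulRight k (C.e l) ∘ₗ LinearMap.mulLeft k (C.e i)) := by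
      refine W_le _ fun p q hp hpN hq hqN hpq => ?_
      intro x hx y hy
      refine IsBimodule.mul_mem_of_peirce (hTbi p) (hTbi q) (fun a b c x hx y hy hx' hy' => ?_) hx hy
      change C.e i * (x * y) * C.e l = 0
      by_cases hx0 : x = 0
      · simp [hx0]
      by_cases hy0 : y = 0
      · simp [hy0]
      have h1 := hTP a b p hp hpN x hx hx' hx0
      have h2 := hTP b c q hq hqN y hy hy' hy0
      by_cases hia : i = a
      · by_cases hlc : l = c
        · exact absurd ⟨b, p, q, hia ▸ h1, hlc ▸ h2, hpq⟩ hno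
        · rw [← hy']
          simp only [mul_assoc, e_mul_e_of_ne (Ne.symm hlc), mul_zero]
      · rw [← hx']
        simp only [← mul_assoc, e_mul_e_of_ne hia, zero_mul]
    have hw0' : C.e i * w * C.e l = 0 := hW hw
    exact hw0 (hw' ▸ hw0')
  -- Up to the top this is acyclic by design: `K = J (N - 2)` maps isomorphically onto `W`, `D (N -
  -- 1)` onto the coboundaries of degree `N`, and `D N` onto the cocycles of degree `N + 1`.
  let J : ℤ → Submodule k C.carrier := fun p =>
    if p < N - 2 then ⊥ else if p = N - 2 then D p ⊓ W.comap C.d else if p = N - 1 then W ⊔ D p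
    else if p = N then (LinearMap.range C.d ⊓ C.gr p) ⊔ D p else C.gr p
  have J_lt : ∀ p, p < N - 2 → J p = ⊥ := fun p hp => if_pos hp
  have J_K : J (N - 2) = D (N - 2) ⊓ W.comap C.d := by simp [J]
  have J_W : J (N - 1) = W ⊔ D (N - 1) := by simp [J]
  have J_N : J N = (LinearMap.range C.d ⊓ C.gr N) ⊔ D N := by
    simp only [J]
    rw [if_neg (by omega), if_neg (by omega), if_neg (by omega), if_pos trivial]
  have J_gt : ∀ p, N < p → J p = C.gr p := fun p hp => by
    simp only [J]
    rw [if_neg (by omega), if_neg (by omega), if_neg (by omega), if_neg (by omega)]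
  have cases_p : ∀ p, p < N - 2 ∨ p = N - 2 ∨ p = N - 1 ∨ p = N ∨ N < p := fun p => by omega
  have J_bi : ∀ p, C.IsBimodule (J p) := by
    intro p
    obtain hp | rfl | rfl | rfl | hp := cases_p p
    · rw [J_lt p hp]
      exact IsBimodule.bot
    · rw [J_K]
      exact (hDbi _).inf W_bi.comap_d
    · rw [J_W]
      exact W_bi.sup (hDbi _)
    · rw [J_N]
      exact (IsBimodule.range_d.inf (IsBimodule.gr _)).sup (hDbi _)
    · rw [J_gt p hp]
      exact IsBimodule.gr _
  have J_gr : ∀ p, J p ≤ C.gr p := by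
    intro p
    obtain hp | rfl | rfl | rfl | hp := cases_p p
    · rw [J_lt p hp]
      exact bot_le
    · rw [J_K]
      exact inf_le_left.trans (hDgr _)
    · rw [J_W]
      exact sup_le W_gr (hDgr _)
    · rw [J_N]
      exact sup_le inf_le_right (hDgr _)
    · rw [J_gt p hp]
  have K_path : ∀ i l, ∀ y ∈ J (N - 2), C.e i * y * C.e l = y → y ≠ 0 →
      ∃ j p q, P i j p ∧ P j l q ∧ p + q = N - 1 := by
    intro i l y hy hy' hy0
    rw [J_K] at hy
    -- `d` is injective on `D (N - 2)` and respects components, so the claim passes from `W` to `K`.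
    refine W_path i l (C.d y) hy.2 ?_ fun hd => hy0 (hD0 _ y hy.1 hd)
    rw [← d_e_mul, ← d_mul_e, hy']
  have K_zero : N = 4 → ∀ y ∈ J (N - 2), y = 0 := by
    intro hN4 y hy
    refine (Submodule.mem_bot k).1 ((J_bi _).le_of_peirce (U := ⊥) (fun i l y hy hy' => ?_) hy)
    by_contra hy0
    obtain ⟨j, p, q, h1, h2, hpq⟩ := K_path i l y hy hy' hy0
    have := hP _ _ _ h1
    have := hP _ _ _ h2
    omega
  have T_cases : ∀ p, ∀ x ∈ T p, x = 0 ∨ p = 0 ∨ p = N ∨ (2 ≤ p ∧ p ≤ N - 2) := by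
    intro p x hx
    by_contra hc
    push Not at hc
    exact hc.1 (T_zero p hc.2.1 hc.2.2.1 (fun hh => by have := hc.2.2.2 hh.1; omega) x hx)
  refine isFormal_of_splitting T J hTgr J_gr hTd hTB hTZ ?_ ?_ ?_ ?_ ?_ ?_ ?_
  · intro p x hx
    obtain hp | rfl | rfl | rfl | hp := cases_p p
    · rw [J_lt p hp, Submodule.mem_bot] at hx
      simp [hx]
    · rw [J_K] at hx
      rw [show N - 2 + 1 = N - 1 by ring, J_W]
      exact Submodule.mem_sup_left hx.2
    · rw [J_W] at hx
      rw [show N - 1 + 1 = N by ring, J_N]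
      obtain ⟨a, ha, b, hb, rfl⟩ := Submodule.mem_sup.1 hx
      have ha : C.d a = 0 := W_d ha
      rw [map_add, ha, zero_add]
      refine Submodule.mem_sup_left ⟨⟨b, rfl⟩, ?_⟩
      have := C.d_mem _ _ (hDgr _ hb)
      rwa [sub_add_cancel] at this
    · rw [J_gt _ (by omega)]
      exact C.d_mem _ _ (J_gr _ hx)
    · rw [J_gt _ (by omega)]
      exact C.d_mem _ _ (J_gr _ hx)
  · intro p x hx hdx
    obtain hp | rfl | rfl | rfl | hp := cases_p p
    · rw [J_lt p hp, Submodule.mem_bot] at hx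
      exact ⟨0, Submodule.zero_mem _, by simp [hx]⟩
    · rw [J_K] at hx
      exact ⟨0, Submodule.zero_mem _, by simp [hD0 _ x hx.1 hdx]⟩
    · rw [J_W] at hx
      obtain ⟨a, ha, b, hb, rfl⟩ := Submodule.mem_sup.1 hx
      have ha' : C.d a = 0 := W_d ha
      rw [map_add, ha', zero_add] at hdx
      rw [hD0 _ b hb hdx, add_zero]
      -- This uses `H^{N-1} = 0`; subtracting a cocycle then moves the primitive into `D (N - 2)`.
      obtain ⟨y, hy, hya⟩ := exact_d (N - 1) (by omega) (by omega) (by omega) a (W_gr ha) ha'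
      rw [show N - 1 - 1 = N - 2 by ring] at hy ⊢
      obtain ⟨y', hy', hyy⟩ := hDZ _ y hy
      rw [map_sub, sub_eq_zero, hya] at hyy
      refine ⟨y', ?_, hyy.symm⟩
      rw [J_K]
      refine ⟨hy', ?_⟩
      change C.d y' ∈ W
      rwa [← hyy]
    · rw [J_N] at hx
      obtain ⟨_, ⟨⟨y, rfl⟩, hyN⟩, b, hb, rfl⟩ := Submodule.mem_sup.1 hx
      rw [map_add, C.d_d, zero_add] at hdx
      rw [hD0 _ b hb hdx, add_zero]
      obtain ⟨y', hy', hyy⟩ := hDZ (p - 1) (C.proj (p - 1) y) (C.proj_mem _ _)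
      rw [map_sub, sub_eq_zero, ← proj_d, sub_add_cancel, C.proj_same hyN] at hyy
      refine ⟨y', ?_, hyy.symm⟩
      rw [J_W]
      exact Submodule.mem_sup_right hy'
    · obtain ⟨y, hy, hyx⟩ := exact_d p (by omega) (by omega) (by omega) x (J_gr _ hx) hdx
      by_cases hp' : p - 1 = N
      · rw [hp'] at hy ⊢
        obtain ⟨y', hy', hyy⟩ := hDZ N y hy
        rw [map_sub, sub_eq_zero, hyx] at hyy
        refine ⟨y', ?_, hyy.symm⟩
        rw [J_N]
        exact Submodule.mem_sup_right hy'
      · rw [J_gt (p - 1) (by omega)]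
        exact ⟨y, hy, hyx⟩
  · intro v
    rw [hT0 0 rfl]
    exact Submodule.subset_span ⟨v, rfl⟩
  · intro p q x hx y hy
    have hxy := mul_mem_gr (hTgr p hx) (hTgr q hy)
    obtain hx0 | rfl | hp := T_cases p x hx
    · simp [hx0]
    · rw [hT0 0 rfl] at hx
      rw [zero_add]
      exact Submodule.mem_sup_left ((hTbi q).span_e_mul hx hy).1
    obtain hy0 | rfl | hq := T_cases q y hy
    · simp [hy0]
    · rw [hT0 0 rfl] at hy
      rw [add_zero]
      exact Submodule.mem_sup_left ((hTbi p).span_e_mul hy hx).2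
    by_cases hgt : N < p + q
    -- Two factors of positive degree: above `N` all of `C` is in `J`, in degree `N` all of `C` is
    -- in `T + J`, degree `N - 1` is `W`, and below that the product vanishes by `hP2`.
    · exact Submodule.mem_sup_right (by rwa [J_gt _ hgt])
    by_cases heq : p + q = N
    · rw [heq, J_N]
      rw [heq] at hxy
      obtain ⟨b, hb, hbz⟩ := hDZ N _ hxy
      obtain ⟨t, ht, z, hz⟩ := hTZ N _ (Submodule.sub_mem _ hxy (hDgr _ hb)) hbz
      have : x * y = t + (C.d z + b) := by rw [hz]; abel
      rw [this]
      refine Submodule.add_mem_sup ht (Submodule.add_mem_sup ⟨⟨z, rfl⟩, ?_⟩ hb)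
      rw [hz]
      exact Submodule.sub_mem _ (Submodule.sub_mem _ hxy (hDgr _ hb)) (hTgr _ ht)
    by_cases hW : p + q = N - 1
    · rw [hW, J_W]
      exact Submodule.mem_sup_right (Submodule.mem_sup_left
        (mul_mem_W p q (by omega) (by omega) (by omega) (by omega) hW x hx y hy))
    · have : x * y ∈ (⊥ : Submodule k C.carrier) := by
        refine IsBimodule.mul_mem_of_peirce (hTbi p) (hTbi q)
          (fun a b c x hx y hy hx' hy' => ?_) hx hy
        by_cases hx0 : x = 0
        · simp [hx0]
        by_cases hy0 : y = 0
        · simp [hy0]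
        have := hP2 _ _ _ _ _ (hTP a b p (by omega) (by omega) x hx hx' hx0)
          (hTP b c q (by omega) (by omega) y hy hy' hy0)
        omega
      rw [(Submodule.mem_bot k).1 this]
      exact Submodule.zero_mem _
  · intro p q x hx y hy
    have hxy := mul_mem_gr (hTgr p hx) (J_gr q hy)
    obtain hx0 | rfl | hp := T_cases p x hx
    · simp [hx0]
    · rw [hT0 0 rfl] at hx
      rw [zero_add]
      exact ((J_bi q).span_e_mul hx hy).1
    by_cases hq : q < N - 2
    · rw [J_lt q hq, Submodule.mem_bot] at hy
      simp [hy]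
    by_cases hgt : N < p + q
    · rwa [J_gt _ hgt]
    -- Since `p ≥ 2` and `q ≥ N - 2`, total degree at most `N` forces equality in both.
    obtain rfl : p = 2 := by omega
    obtain rfl : q = N - 2 := by omega
    have : x * y ∈ (⊥ : Submodule k C.carrier) := by
      refine IsBimodule.mul_mem_of_peirce (hTbi _) (J_bi _)
        (fun a b c x hx y hy hx' hy' => ?_) hx hy
      by_cases hx0 : x = 0
      · simp [hx0]
      by_cases hy0 : y = 0
      · simp [hy0]
      obtain ⟨j, p', q', h1, h2, hpq⟩ := K_path b c y hy hy' hy0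
      have := hP3 _ _ _ _ _ _ _ (hTP a b 2 (by omega) (by omega) x hx hx' hx0) h1 h2
      omega
    rw [(Submodule.mem_bot k).1 this]
    exact Submodule.zero_mem _
  · intro p q x hx y hy
    have hxy := mul_mem_gr (J_gr p hx) (hTgr q hy)
    obtain hy0 | rfl | hq := T_cases q y hy
    · simp [hy0]
    · rw [hT0 0 rfl] at hy
      rw [add_zero]
      exact ((J_bi p).span_e_mul hy hx).2
    by_cases hp : p < N - 2
    · rw [J_lt p hp, Submodule.mem_bot] at hx
      simp [hx]
    by_cases hgt : N < p + q
    · rwa [J_gt _ hgt]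
    obtain rfl : q = 2 := by omega
    obtain rfl : p = N - 2 := by omega
    have : x * y ∈ (⊥ : Submodule k C.carrier) := by
      refine IsBimodule.mul_mem_of_peirce (J_bi _) (hTbi _)
        (fun a b c x hx y hy hx' hy' => ?_) hx hy
      by_cases hx0 : x = 0
      · simp [hx0]
      by_cases hy0 : y = 0
      · simp [hy0]
      obtain ⟨j, p', q', h1, h2, hpq⟩ := K_path a b x hx hx' hx0
      have := hP3 _ _ _ _ _ _ _ h1 h2 (hTP b c 2 (by omega) (by omega) y hy hy' hy0)
      omega
    rw [(Submodule.mem_bot k).1 this]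
    exact Submodule.zero_mem _
  · intro p q x hx y hy
    have hxy := mul_mem_gr (J_gr p hx) (J_gr q hy)
    by_cases hp : p < N - 2
    · rw [J_lt p hp, Submodule.mem_bot] at hx
      simp [hx]
    by_cases hq : q < N - 2
    · rw [J_lt q hq, Submodule.mem_bot] at hy
      simp [hy]
    by_cases hgt : N < p + q
    · rwa [J_gt _ hgt]
    -- Here `2 (N - 2) ≤ p + q ≤ N`, which forces `N = 4`.
    obtain rfl : p = N - 2 := by omega
    rw [K_zero (by omega) x hx, zero_mul]
    exact Submodule.zero_mem _

end DGAlg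

/-! ### The zig-zag algebra -/

namespace ZigzagGen

/-- The arrows of the cyclic quiver among the generators. -/
def IsArrow {n : ℕ} : ZigzagGen n → Prop
  | .vertex _ => False
  | .up _ => True
  | .down _ => True

/-- The starting point of a path of length at most one. -/
def source {n : ℕ} : ZigzagGen n → ZMod n
  | .vertex i => i
  | .up i => i
  | .down i => i + 1

/-- The end point of a path of length at most one. -/
def target {n : ℕ} : ZigzagGen n → ZMod n
  | .vertex i => i
  | .up i => i + 1
  | .down i => i

end ZigzagGen

namespace Zigzag

open ZigzagGen

/-! ### Degrees of arrows and of composable triples of arrows. -/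

section Degrees

variable {n : ℕ} {N : ℕ}

/-- The second alternative is the only place where the parity of the labels can fail to alternate.
-/
theorem label_add_one [NeZero n] (i : ZMod n) :
    label (i + 1) = label i + 1 ∨ (label (i + 1) = 1 ∧ label i = n) := by
  have hi := ZMod.val_lt i
  have h := ZMod.val_add i 1
  rw [ZMod.val_one_eq_one_mod, Nat.add_mod_mod] at h
  rcases Nat.lt_or_ge (i.val + 1) n with h1 | h1
  · rw [Nat.mod_eq_of_lt h1] at h
    simp only [label, h]
    split_ifs <;> first | contradiction | omega
  · have h2 : i.val + 1 = n := by omega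
    rw [h2, Nat.mod_self] at h
    simp only [label, h]
    split_ifs <;> first | contradiction | omega

theorem two_mul_dd (N : ℕ) (i : ZMod n) :
    2 * dd N i = N ∨ (2 * dd N i = N + 1 ∧ Odd N ∧ Even (label i)) ∨
      (2 * dd N i = N - 1 ∧ Odd N ∧ Odd (label i)) := by
  by_cases hN : Even N
  · left
    rw [dd, if_pos hN]
    obtain ⟨m, rfl⟩ := hN
    omega
  · right
    rw [dd, if_neg hN]
    rw [Nat.not_even_iff_odd] at hN
    rcases Nat.even_or_odd (label i) with h | h
    · left
      rw [h.neg_one_pow]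
      refine ⟨?_, hN, h⟩
      obtain ⟨m, rfl⟩ := hN
      omega
    · right
      rw [h.neg_one_pow]
      refine ⟨?_, hN, h⟩
      obtain ⟨m, rfl⟩ := hN
      omega

theorem deg_arrow {g : ZigzagGen n} (hg : g.IsArrow) :
    (N : ℤ) - 1 ≤ 2 * deg N g ∧ 2 * deg N g ≤ N + 1 := by
  cases g with
  | vertex i => exact hg.elim
  | up i =>
    have := two_mul_dd N i
    simp only [deg]
    omega
  | down i =>
    have := two_mul_dd N i
    simp only [deg]
    omega

theorem deg_arrow_bounds (hN : 4 ≤ N) {g : ZigzagGen n} (hg : g.IsArrow) :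
    2 ≤ deg N g ∧ deg N g ≤ N - 2 := by
  have := deg_arrow (N := N) hg
  omega

/-- The total degree of a path of three arrows is at least `N + 2`. -/
theorem deg_three_arrows [NeZero n] (hN : 4 ≤ N) (hn : 3 ≤ n) {f g h : ZigzagGen n} (hf : f.IsArrow)
    (hg : g.IsArrow) (hh : h.IsArrow) (hfg : f.target = g.source) (hgh : g.target = h.source) :
    (N : ℤ) + 2 ≤ deg N f + deg N g + deg N h := by
  have key : ∀ i : ZMod n, 2 * dd N i = N ∨ (2 * dd N i = N + 1 ∧ N % 2 = 1 ∧ label i % 2 = 0) ∨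
      (2 * dd N i = N - 1 ∧ N % 2 = 1 ∧ label i % 2 = 1) := by
    intro i
    simpa only [Nat.odd_iff, Nat.even_iff] using two_mul_dd N i
  cases f with
  | vertex i => exact hf.elim
  | up i =>
    cases g with
    | vertex j => exact hg.elim
    | up j =>
      cases h with
      | vertex l => exact hh.elim
      | up l =>
        simp only [source, target] at hfg hgh
        subst hfg hgh
        -- All three labels odd would require wrapping from `n` to `1` twice in a row, impossible
        -- for `n ≥ 3`. So for odd `N` the sum is at least `(3N - 1)/2`, which suffices because `N ≥
        -- 5`.
        have := key i
        have := key (i + 1)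
        have := key (i + 1 + 1)
        have := label_add_one i
        have := label_add_one (i + 1)
        simp only [deg]
        omega
      | down l =>
        -- An arrow followed by its reverse contributes exactly `N`, and the remaining arrow at
        -- least `2`.
        simp only [source, target] at hfg hgh
        obtain rfl := add_right_cancel hgh
        have := key i
        have := key j
        simp only [deg]
        omega
    | down j =>
      simp only [source, target] at hfg
      obtain rfl := add_right_cancel hfg
      have := deg_arrow (N := N) hh
      have := key i
      have h1 : deg N (.up i) = dd N i := rfl
      have h2 : deg N (.down i) = N - dd N i := rfl
      omega
  | down i =>
    cases g with
    | vertex j => exact hg.elim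
    | up j =>
      simp only [source, target] at hfg
      subst hfg
      have := deg_arrow (N := N) hh
      have h1 : deg N (.up i) = dd N i := rfl
      have h2 : deg N (.down i) = N - dd N i := rfl
      omega
    | down j =>
      cases h with
      | vertex l => exact hh.elim
      | up l =>
        simp only [source, target] at hfg hgh
        subst hgh
        have := key i
        have := key j
        simp only [deg]
        omega
      | down l =>
        simp only [source, target] at hfg hgh
        subst hgh hfg
        -- Downward arrows have the smaller degree at even labels, and consecutive labels are never
        -- both even, since wrapping ends at `1`.
        have := key l
        have := key (l + 1)
        have := key (l + 1 + 1)
        have := label_add_one l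
        have := label_add_one (l + 1)
        simp only [deg]
        omega

end Degrees

/-! ### Products of generators and spanning sets of the homogeneous parts. -/

variable (k : Type u) [Field k] {n : ℕ} [NeZero n]

theorem vertex_mul_vertex_of_ne {i j : ZMod n} (h : i ≠ j) :
    gen k (.vertex i) * gen k (.vertex j) = 0 := by
  have h' := rel k n (.ortho i j h)
  simp only [fv, map_mul, map_zero] at h'
  exact h'

theorem vertex_mul_vertex (i : ZMod n) :
    gen k (.vertex i) * gen k (.vertex i) = gen k (.vertex i) := by
  have h' := rel k n (.idem i)
  simp only [fv, map_mul] at h'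
  exact h'

theorem source_mul (g : ZigzagGen n) : gen k (.vertex g.source) * gen k g = gen k g := by
  cases g with
  | vertex i => exact vertex_mul_vertex k i
  | up i =>
    have h' := rel k n (.up_source i)
    simp only [fv, fu, map_mul] at h'
    exact h'
  | down i =>
    have h' := rel k n (.down_source i)
    simp only [fv, fd, map_mul] at h'
    exact h'

theorem mul_target (g : ZigzagGen n) : gen k g * gen k (.vertex g.target) = gen k g := by
  cases g with
  | vertex i => exact vertex_mul_vertex k i
  | up i =>
    have h' := rel k n (.up_target i)
    simp only [fv, fu, map_mul] at h'
    exact h'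
  | down i =>
    have h' := rel k n (.down_target i)
    simp only [fv, fd, map_mul] at h'
    exact h'

theorem gen_mul_gen_of_ne {g h : ZigzagGen n} (hgh : g.target ≠ h.source) :
    gen k g * gen k h = 0 := by
  rw [← mul_target k g, ← source_mul k h, mul_assoc, ← mul_assoc (gen k (.vertex g.target)),
    vertex_mul_vertex_of_ne k hgh, zero_mul, mul_zero]

theorem up_mul_up (i j : ZMod n) : gen k (.up i) * gen k (.up j) = 0 := by
  by_cases hij : i + 1 = j
  · obtain rfl : i = j - 1 := eq_sub_of_add_eq hij
    have h' := rel k n (.up_up j)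
    simp only [fu, map_mul, map_zero] at h'
    exact h'
  · exact gen_mul_gen_of_ne k hij

theorem down_mul_down (i j : ZMod n) : gen k (.down i) * gen k (.down j) = 0 := by
  by_cases hij : i = j + 1
  · obtain rfl : j = i - 1 := eq_sub_of_add_eq hij.symm
    have h' := rel k n (.down_down i)
    simp only [fd, map_mul, map_zero] at h'
    exact h'
  · exact gen_mul_gen_of_ne k hij

/-- Brings every loop into the form used in `paths`, first up and then down. -/
theorem down_mul_up (i : ZMod n) :
    gen k (.down i) * gen k (.up i) = gen k (.up (i + 1)) * gen k (.down (i + 1)) := by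
  have h' := rel k n (.loop (i + 1))
  simp only [fd, fu, map_mul, add_sub_cancel_right] at h'
  exact h'.symm

/-- The paths `(i)`, the arrows, and the loops `(i|i+1|i)` of degree `p`. -/
def paths (N : ℕ) (p : ℤ) : Set (Alg k n) :=
  {x | (∃ g : ZigzagGen n, gen k g = x ∧ deg N g = p) ∨
    ∃ i : ZMod n, gen k (.up i) * gen k (.down i) = x ∧ (N : ℤ) = p}

/-- The inductive step for reducing words to `paths`. Only spanning is needed, never linear
independence. -/
theorem gen_mul_paths (N : ℕ) (g : ZigzagGen n) {p : ℤ} {x : Alg k n} (hx : x ∈ paths k N p) :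
    gen k g * x = 0 ∨ gen k g * x ∈ paths k N (deg N g + p) := by
  obtain ⟨h, rfl, rfl⟩ | ⟨i, rfl, rfl⟩ := hx
  · by_cases hgh : g.target = h.source
    · cases g with
      | vertex i =>
        right
        simp only [target] at hgh
        rw [hgh, source_mul]
        exact Or.inl ⟨h, rfl, by simp [deg]⟩
      | up i =>
        cases h with
        | vertex j =>
          right
          simp only [source] at hgh
          rw [← hgh, mul_target]
          exact Or.inl ⟨_, rfl, by simp [deg]⟩
        | up j => exact Or.inl (up_mul_up k i j)
        | down j =>
          obtain rfl := add_right_cancel (a := i) (b := 1) hgh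
          exact Or.inr (Or.inr ⟨i, rfl, by simp [deg]⟩)
      | down i =>
        cases h with
        | vertex j =>
          right
          simp only [source] at hgh
          rw [← hgh, mul_target]
          exact Or.inl ⟨_, rfl, by simp [deg]⟩
        | up j =>
          simp only [source, target] at hgh
          subst hgh
          exact Or.inr (Or.inr ⟨i + 1, (down_mul_up k i).symm, by simp [deg]⟩)
        | down j => exact Or.inl (down_mul_down k i j)
    · exact Or.inl (gen_mul_gen_of_ne k hgh)
  · rw [← mul_assoc]
    by_cases hgi : g.target = i
    · cases g with
      | vertex j =>
        right
        simp only [target] at hgi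
        subst hgi
        refine Or.inr ⟨j, ?_, by simp [deg]⟩
        have := source_mul k (.up j)
        simp only [source] at this
        rw [this]
      | up j =>
        left
        rw [up_mul_up, zero_mul]
      | down j =>
        left
        simp only [target] at hgi
        subst hgi
        -- Rewriting the loop at its base point as the other loop exposes two consecutive downward
        -- arrows.
        rw [down_mul_up, mul_assoc, down_mul_down, mul_zero]
    · left
      rw [gen_mul_gen_of_ne k (h := .up i) hgi, zero_mul]

/-- The homogeneous parts are spanned by the vertices, the arrows and the loops. -/
theorem gr_le_span_paths (N : ℕ) (p : ℤ) : gr k n N p ≤ Submodule.span k (paths k N p) := by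
  refine Submodule.span_le.2 ?_
  rintro _ ⟨l, rfl, rfl⟩
  induction l with
  | nil =>
    have h := rel k n .one
    simp only [map_sum, map_one] at h
    simp only [List.map_nil, List.prod_nil, List.sum_nil, ← h]
    exact Submodule.sum_mem _ fun i _ => Submodule.subset_span (Or.inl ⟨.vertex i, rfl, rfl⟩)
  | cons g l ih =>
    simp only [List.map_cons, List.prod_cons, List.sum_cons]
    have h : Submodule.span k (paths k N (l.map (deg N)).sum) ≤
        (Submodule.span k (paths k N (deg N g + (l.map (deg N)).sum))).comap
          (LinearMap.mulLeft k (gen k g)) := by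
      refine Submodule.span_le.2 fun x hx => ?_
      change gen k g * x ∈ Submodule.span k (paths k N (deg N g + (l.map (deg N)).sum))
      obtain h0 | h1 := gen_mul_paths k N g hx
      · rw [h0]
        exact Submodule.zero_mem _
      · exact Submodule.subset_span h1
    exact h ih

/-- Arrows have degree at least `2` and loops have degree `N`, so only vertices remain. -/
theorem gr_zero_le {N : ℕ} (hN : 4 ≤ N) :
    gr k n N 0 ≤ Submodule.span k (Set.range fun i : ZMod n => gen k (.vertex i)) := by
  refine (gr_le_span_paths k N 0).trans (Submodule.span_mono ?_)
  rintro x (⟨g, rfl, hg⟩ | ⟨i, -, hi⟩)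
  · cases g with
    | vertex i => exact ⟨i, rfl⟩
    | up i =>
      have := deg_arrow_bounds hN (g := .up i) trivial
      omega
    | down i =>
      have := deg_arrow_bounds hN (g := .down i) trivial
      omega
  · omega

/-- A nonzero component in a degree other than `0` and `N` comes from an arrow. -/
theorem exists_arrow {N : ℕ} {p : ℤ} (hp : p ≠ 0) (hpN : p ≠ N) {i j : ZMod n} {x : Alg k n}
    (hx : x ∈ gr k n N p) (hij : gen k (.vertex i) * x * gen k (.vertex j) = x) (hx0 : x ≠ 0) :
    ∃ g : ZigzagGen n, g.IsArrow ∧ g.source = i ∧ g.target = j ∧ deg N g = p := by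
  by_contra hno
  have h : Submodule.span k (paths k N p) ≤ LinearMap.ker
      (LinearMap.mulRight k (gen k (.vertex j)) ∘ₗ LinearMap.mulLeft k (gen k (.vertex i))) := by
    refine Submodule.span_le.2 ?_
    rintro _ (⟨g, rfl, hg⟩ | ⟨i, -, hi⟩)
    · change gen k (.vertex i) * gen k g * gen k (.vertex j) = 0
      have harr : g.IsArrow := by
        cases g with
        | vertex i => exact absurd hg.symm hp
        | up i => trivial
        | down i => trivial
      by_cases h1 : i = g.source
      · by_cases h2 : g.target = j
        · exact absurd ⟨g, harr, h1.symm, h2, hg⟩ hno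
        · rw [mul_assoc, gen_mul_gen_of_ne k (h := .vertex j) h2, mul_zero]
      · rw [gen_mul_gen_of_ne k (g := .vertex i) h1, zero_mul]
    · exact absurd hi.symm hpN
  have h0 : gen k (.vertex i) * x * gen k (.vertex j) = 0 := h (gr_le_span_paths k N p hx)
  exact hx0 (hij.symm.trans h0)

/-- Detected by the character of the simple module at `i`, which kills all arrows and all other
vertices. It ensures that no idempotent of `C` is a coboundary. -/
theorem vertex_ne_zero (i : ZMod n) : gen k (.vertex i) ≠ 0 := by
  classical
  let f : FreeAlgebra k (ZigzagGen n) →ₐ[k] k := FreeAlgebra.lift k fun g =>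
    match g with
    | .vertex j => if j = i then 1 else 0
    | .up _ => 0
    | .down _ => 0
  have hv : ∀ j, f (fv k j) = if j = i then 1 else 0 := fun j => FreeAlgebra.lift_ι_apply _ _
  have hu : ∀ j, f (fu k j) = 0 := fun j => FreeAlgebra.lift_ι_apply _ _
  have hd : ∀ j, f (fd k j) = 0 := fun j => FreeAlgebra.lift_ι_apply _ _
  have hf : ∀ ⦃x y⦄, Rel k n x y → f x = f y := by
    intro x y h
    cases h with
    | idem j => simp [hv]
    | ortho j l h =>
      simp only [map_mul, hv, map_zero, mul_ite, mul_one, mul_zero]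
      split_ifs with h1 h2
      · exact absurd (h2.trans h1.symm) h
      all_goals rfl
    | one => simp [hv]
    | _ => simp [hu, hd]
  intro h
  have h1 : RingQuot.liftAlgHom k ⟨f, hf⟩ (gen k (.vertex i)) = f (fv k i) :=
    RingQuot.liftAlgHom_mkAlgHom_apply k f hf _
  rw [h, map_zero, hv, if_pos rfl] at h1
  exact zero_ne_one h1

end Zigzag

/-! ### Intrinsic formality of the zig-zag algebra. -/

theorem mainTheorem6 (k : Type u) [Field k] [IsAlgClosed k] (n N : ℕ) [NeZero n]
    (hN : 4 ≤ N) (hn : 3 ≤ n) :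
    GrAlg.IsIntrinsicallyFormal.{u, w} (zigzagAlgebra k n N) := by
  rintro C ⟨φ⟩
  have hcls : ∀ (x : C.carrier) (hx : C.d x = 0),
      φ.toAlgEquiv (C.cls ⟨x, hx⟩) = 0 ↔ ∃ y, C.d y = x := by
    intro x hx
    rw [map_eq_zero_iff _ φ.toAlgEquiv.injective]
    exact C.cls_eq_zero
  have hgr : ∀ p (x : C.carrier) (hx : C.d x = 0), x ∈ C.gr p →
      φ.toAlgEquiv (C.cls ⟨x, hx⟩) ∈ Zigzag.gr k n N p := fun p x hx hxp =>
    (φ.map_gr p _).2 (C.mem_Hgr.2 ⟨⟨x, hx⟩, hxp, rfl⟩)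
  have he : ∀ i, φ.toAlgEquiv (C.cls ⟨C.e i, C.d_e i⟩) = Zigzag.gen k (.vertex i) := φ.map_e
  -- `P i j p` is the existence of an arrow from `i` to `j` of degree `p`.
  refine DGAlg.isFormal_of_degrees (N := N) (by exact_mod_cast hN)
    (fun i j p => ∃ g : ZigzagGen n, g.IsArrow ∧ g.source = i ∧ g.target = j ∧ Zigzag.deg N g = p)
    ?_ ?_ ?_ ?_ ?_ ?_
  · rintro i j p ⟨g, hg, -, -, rfl⟩
    exact Zigzag.deg_arrow_bounds hN hg
  · rintro i j l p q ⟨g, hg, -, -, rfl⟩ ⟨h, hh, -, -, rfl⟩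
    have := Zigzag.deg_arrow (N := N) hg
    have := Zigzag.deg_arrow (N := N) hh
    omega
  · rintro i j l m p q r ⟨f, hf, -, rfl, rfl⟩ ⟨g, hg, hfg, rfl, rfl⟩ ⟨h, hh, hgh, -, rfl⟩
    exact Zigzag.deg_three_arrows hN hn hf hg hh hfg.symm hgh.symm
  · intro i j p hp hpN x hx hdx hij hx0
    refine Zigzag.exists_arrow k hp hpN (hgr p x hdx hx) ?_ fun h0 => hx0 ((hcls x hdx).1 h0)
    rw [← he, ← he, ← map_mul, ← map_mul, ← map_mul, ← map_mul]
    congr 2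
    exact Subtype.ext hij
  · intro x hx hdx
    have h1 := Zigzag.gr_zero_le k hN (hgr 0 x hdx hx)
    obtain ⟨c, hc⟩ := (Submodule.mem_span_range_iff_exists_fun k).1 h1
    have hd : C.d (∑ i, c i • C.e i) = 0 := by simp [C.d_e]
    refine ⟨∑ i, c i • C.e i, Submodule.sum_mem _ fun i _ =>
      Submodule.smul_mem _ _ (Submodule.subset_span ⟨i, rfl⟩), ?_⟩
    refine (hcls (x - ∑ i, c i • C.e i) (by rw [map_sub, hdx, hd, sub_zero])).1 ?_
    have h2 : (⟨x - ∑ i, c i • C.e i, by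
        rw [DGAlg.mem_cocycles, map_sub, hdx, hd, sub_zero]⟩ : C.cocycles) =
        ⟨x, hdx⟩ - ∑ i, c i • ⟨C.e i, C.d_e i⟩ := by
      apply Subtype.ext
      simp
    rw [h2, map_sub, map_sub, map_sum, map_sum, ← hc, sub_eq_zero]
    exact Finset.sum_congr rfl fun i _ => by rw [map_smul, map_smul, he]
  · intro i hi
    exact Zigzag.vertex_ne_zero k i ((he i).symm.trans ((hcls _ _).2 hi))
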